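/- Let $\mathbb T=\{w\in\mathbb C:|w|=1\}$, let $\Omega=\mathbb T^{\mathbb Z^2}$ with the $\sigma$-algebra generated by the cylinder sets and the product measure $\mathbb P=\bigotimes_{\mu\in\mathbb Z^2}d\ell$, where $d\ell$ is the normalized Lebesgue measure on $\mathbb T$, and let $\mathbb E$ be the expectation with respect to $\mathbb P$. Let $\{e_\mu\}_{\mu\in\mathbb Z^2}$ be the standard basis of $\ell^2(\mathbb Z^2)$, and for $\omega\in\Omega$ let $D_\omega$ be the diagonal unitary operator $D_\omega e_\mu=\omega_\mu e_\mu$. Let $S_\circlearrowleft$ and $S_\circlearrowright$ be the unitary operators on $\ell^2(\mathbb Z^2)$ that permute the standard basis as follows, for all $j,k\in\mathbb Z$: \[S_\circlearrowleft:\ e_{(2j,2k)}\mapsto e_{(2j+1,2k)}\mapsto e_{(2j+1,2k+1)}\mapsto e_{(2j,2k+1)}\mapsto e_{(2j,2k)},\] \[S_\circlearrowright:\ e_{(2j,2k)}\mapsto e_{(2j,2k-1)}\mapsto e_{(2j-1,2k-1)}\mapsto e_{(2j-1,2k)}\mapsto e_{(2j,2k)}.\] For $\varphi\in\mathbb R$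 put $U_\omega(\varphi)=D_\omega\left(\cos\varphi\, S_\circlearrowleft+i\sin\varphi\, S_\circlearrowright\right)$, which is a unitary operator. For $\mu\in\mathbb Z^2$ let $|\mu|=(\mu_1^2+\mu_2^2)^{1/2}$. Then for each $s\in(0,1)$ there are numbers $\varphi_0,c,g>0$ such that for all real $\varphi$ with $|\varphi|\le\varphi_0$, all $\mu,\nu\in\mathbb Z^2$ and all $z\in\mathbb C\setminus\mathbb T$, \[\mathbb E\left(\left|\left\langle e_\mu,(U_\omega(\varphi)-z)^{-1}e_\nu\right\rangle\right|^s\right)\le c\,e^{-g|\mu-\nu|}.\] -/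

import Mathlib

open MeasureTheory

noncomputable section

/-- The sites of the lattice `ℤ²`. -/
abbrev Site : Type := ℤ × ℤ

/-- The Euclidean norm of a lattice point, `|μ| = (μ₁² + μ₂²)^{1/2}`. -/
def siteNorm (μ : Site) : ℝ := Real.sqrt ((μ.1 : ℝ) ^ 2 + (μ.2 : ℝ) ^ 2)

/-- The Hilbert space `ℓ²(ℤ²)` of complex valued functions. -/
abbrev L2Lattice : Type := lp (fun _ : Site => ℂ) 2

/-- The standard basis vector `e_μ`, with `(e_μ)_ν = δ_{μν}`. -/
def basisVec (μ : Site) : L2Lattice := lp.single 2 μ (1 : ℂ)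

theorem memℓp_two_iff_summable (f : Site → ℂ) :
    Memℓp f 2 ↔ Summable fun μ => ‖f μ‖ ^ (2 : ℕ) := by
  rw [memℓp_gen_iff (by norm_num)]
  norm_num

theorem L2Lattice.norm_sq (ψ : L2Lattice) : ‖ψ‖ ^ 2 = ∑' μ, ‖ψ μ‖ ^ 2 := by
  have h := lp.norm_rpow_eq_tsum (p := 2) (by norm_num) ψ
  norm_num at h
  exact h

theorem L2Lattice.norm_eq_of_tsum_eq {ψ χ : L2Lattice}
    (h : ∑' μ, ‖ψ μ‖ ^ 2 = ∑' μ, ‖χ μ‖ ^ 2) : ‖ψ‖ = ‖χ‖ := by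
  rw [← L2Lattice.norm_sq, ← L2Lattice.norm_sq] at h
  exact (pow_left_inj₀ (norm_nonneg _) (norm_nonneg _) two_ne_zero).1 h

theorem memℓp_comp_perm (σ : Equiv.Perm Site) (ψ : L2Lattice) :
    Memℓp (fun μ => ψ (σ.symm μ)) 2 := by
  rw [memℓp_two_iff_summable]
  exact (σ.symm.summable_iff (f := fun μ => ‖ψ μ‖ ^ 2)).2
    ((memℓp_two_iff_summable _).1 (lp.memℓp ψ))

theorem memℓp_phase_mul (ω : Site → Circle) (ψ : L2Lattice) :
    Memℓp (fun μ => (ω μ : ℂ) * ψ μ) 2 := by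
  rw [memℓp_two_iff_summable]
  simpa only [norm_mul, Circle.norm_coe, one_mul] using (memℓp_two_iff_summable _).1 (lp.memℓp ψ)

/-- The unitary of `ℓ²(ℤ²)` that permutes the standard basis, `e_μ ↦ e_{σ μ}`. -/
def permOp (σ : Equiv.Perm Site) : L2Lattice ≃ₗᵢ[ℂ] L2Lattice where
  toFun ψ := ⟨fun μ => ψ (σ.symm μ), memℓp_comp_perm σ ψ⟩
  map_add' ψ χ := rfl
  map_smul' a ψ := rfl
  invFun ψ := ⟨fun μ => ψ (σ μ), memℓp_comp_perm σ.symm ψ⟩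
  left_inv ψ := by
    ext μ
    exact congrArg ψ (σ.symm_apply_apply μ)
  right_inv ψ := by
    ext μ
    exact congrArg ψ (σ.apply_symm_apply μ)
  norm_map' ψ := L2Lattice.norm_eq_of_tsum_eq (σ.symm.tsum_eq fun μ => ‖ψ μ‖ ^ 2)

theorem permOp_apply (σ : Equiv.Perm Site) (ψ : L2Lattice) (μ : Site) :
    permOp σ ψ μ = ψ (σ.symm μ) := rfl

theorem permOp_basisVec (σ : Equiv.Perm Site) (μ : Site) :
    permOp σ (basisVec μ) = basisVec (σ μ) := by
  ext ν
  rw [permOp_apply, basisVec, basisVec, lp.single_apply, lp.single_apply]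
  simp [Pi.single_apply, Equiv.symm_apply_eq]

/-- The unitary diagonal operator `D_ω`, with `(D_ω)_{μν} = ω_μ δ_{μν}`. -/
def phaseOp (ω : Site → Circle) : L2Lattice ≃ₗᵢ[ℂ] L2Lattice where
  toFun ψ := ⟨fun μ => (ω μ : ℂ) * ψ μ, memℓp_phase_mul ω ψ⟩
  map_add' ψ χ := by
    ext μ
    exact mul_add _ _ _
  map_smul' a ψ := by
    ext μ
    exact mul_left_comm _ _ _
  invFun ψ := ⟨fun μ => ((ω⁻¹) μ : ℂ) * ψ μ, memℓp_phase_mul ω⁻¹ ψ⟩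
  left_inv ψ := by
    ext μ
    change (((ω μ)⁻¹ : Circle) : ℂ) * ((ω μ : ℂ) * ψ μ) = ψ μ
    rw [← mul_assoc, ← Circle.coe_mul]
    simp
  right_inv ψ := by
    ext μ
    change (ω μ : ℂ) * ((((ω μ)⁻¹ : Circle) : ℂ) * ψ μ) = ψ μ
    rw [← mul_assoc, ← Circle.coe_mul]
    simp
  norm_map' ψ := L2Lattice.norm_eq_of_tsum_eq (tsum_congr fun μ => by
    change ‖(ω μ : ℂ) * ψ μ‖ ^ 2 = _
    rw [norm_mul, Circle.norm_coe, one_mul])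

theorem phaseOp_apply (ω : Site → Circle) (ψ : L2Lattice) (μ : Site) :
    phaseOp ω ψ μ = (ω μ : ℂ) * ψ μ := rfl

/-- The anticlockwise rotation of the blocks
`{(2j,2k), (2j+1,2k), (2j+1,2k+1), (2j,2k+1)}`: each site goes to the next one in this
cyclic order. -/
def anticlockwise : Equiv.Perm Site where
  toFun μ :=
    if μ.1 % 2 = 0 then
      if μ.2 % 2 = 0 then (μ.1 + 1, μ.2) else (μ.1, μ.2 - 1)
    else
      if μ.2 % 2 = 0 then (μ.1, μ.2 + 1) else (μ.1 - 1, μ.2)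
  invFun μ :=
    if μ.1 % 2 = 0 then
      if μ.2 % 2 = 0 then (μ.1, μ.2 + 1) else (μ.1 + 1, μ.2)
    else
      if μ.2 % 2 = 0 then (μ.1 - 1, μ.2) else (μ.1, μ.2 - 1)
  left_inv μ := by
    ext <;> dsimp only <;> split_ifs <;> (try dsimp only at *) <;> omega
  right_inv μ := by
    ext <;> dsimp only <;> split_ifs <;> (try dsimp only at *) <;> omega

/-- The clockwise rotation of the blocks
`{(2j,2k), (2j,2k-1), (2j-1,2k-1), (2j-1,2k)}`: each site goes to the next one in this
cyclic order. -/
def clockwise : Equiv.Perm Site where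
  toFun μ :=
    if μ.1 % 2 = 0 then
      if μ.2 % 2 = 0 then (μ.1, μ.2 - 1) else (μ.1 - 1, μ.2)
    else
      if μ.2 % 2 = 0 then (μ.1 + 1, μ.2) else (μ.1, μ.2 + 1)
  invFun μ :=
    if μ.1 % 2 = 0 then
      if μ.2 % 2 = 0 then (μ.1 - 1, μ.2) else (μ.1, μ.2 + 1)
    else
      if μ.2 % 2 = 0 then (μ.1, μ.2 - 1) else (μ.1 + 1, μ.2)
  left_inv μ := by
    ext <;> dsimp only <;> split_ifs <;> (try dsimp only at *) <;> omega
  right_inv μ := by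
    ext <;> dsimp only <;> split_ifs <;> (try dsimp only at *) <;> omega

theorem anticlockwise_block (j k : ℤ) :
    anticlockwise (2 * j, 2 * k) = (2 * j + 1, 2 * k) ∧
    anticlockwise (2 * j + 1, 2 * k) = (2 * j + 1, 2 * k + 1) ∧
    anticlockwise (2 * j + 1, 2 * k + 1) = (2 * j, 2 * k + 1) ∧
    anticlockwise (2 * j, 2 * k + 1) = (2 * j, 2 * k) := by
  refine ⟨?_, ?_, ?_, ?_⟩ <;>
    · ext <;> simp only [anticlockwise, Equiv.coe_fn_mk] <;> split_ifs <;> dsimp only <;> omega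

theorem clockwise_block (j k : ℤ) :
    clockwise (2 * j, 2 * k) = (2 * j, 2 * k - 1) ∧
    clockwise (2 * j, 2 * k - 1) = (2 * j - 1, 2 * k - 1) ∧
    clockwise (2 * j - 1, 2 * k - 1) = (2 * j - 1, 2 * k) ∧
    clockwise (2 * j - 1, 2 * k) = (2 * j, 2 * k) := by
  refine ⟨?_, ?_, ?_, ?_⟩ <;>
    · ext <;> simp only [clockwise, Equiv.coe_fn_mk] <;> split_ifs <;> dsimp only <;> omega

/-- The bounded operator on `ℓ²(ℤ²)` given by a permutation of the standard basis. -/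
def permCLM (σ : Equiv.Perm Site) : L2Lattice →L[ℂ] L2Lattice :=
  (permOp σ).toContinuousLinearEquiv.toContinuousLinearMap

/-- The operator `S(φ) = cos φ S_↺ + i sin φ S_↻`. -/
def scatteringOp (φ : ℝ) : L2Lattice →L[ℂ] L2Lattice :=
  (Real.cos φ : ℂ) • permCLM anticlockwise + (Complex.I * (Real.sin φ : ℂ)) • permCLM clockwise

/-- The operator `U_ω(φ) = D_ω S(φ)`. -/
def networkOp (φ : ℝ) (ω : Site → Circle) : L2Lattice →L[ℂ] L2Lattice :=
  (phaseOp ω).toContinuousLinearEquiv.toContinuousLinearMap * scatteringOp φ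

theorem permCLM_star (σ : Equiv.Perm Site) :
    star (permCLM σ) = permCLM σ.symm :=
  LinearIsometryEquiv.adjoint_eq_symm (permOp σ)

theorem permCLM_mul (σ τ : Equiv.Perm Site) :
    permCLM σ * permCLM τ = permCLM (σ * τ) := rfl

theorem permCLM_one : permCLM 1 = 1 := rfl

theorem anticlockwise_symm_mul_clockwise :
    anticlockwise.symm * clockwise = clockwise.symm * anticlockwise := by
  ext μ <;>
    simp only [Equiv.Perm.mul_apply, anticlockwise, clockwise, Equiv.coe_fn_mk,
      Equiv.coe_fn_symm_mk] <;>
    split_ifs <;> (try dsimp only at *) <;> omega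

theorem anticlockwise_mul_clockwise_symm :
    anticlockwise * clockwise.symm = clockwise * anticlockwise.symm := by
  ext μ <;>
    simp only [Equiv.Perm.mul_apply, anticlockwise, clockwise, Equiv.coe_fn_mk,
      Equiv.coe_fn_symm_mk] <;>
    split_ifs <;> (try dsimp only at *) <;> omega

theorem scatteringOp_mem_unitary (φ : ℝ) :
    scatteringOp φ ∈ unitary (L2Lattice →L[ℂ] L2Lattice) := by
  have hcs : (Real.cos φ : ℂ) * (Real.cos φ : ℂ) + (Real.sin φ : ℂ) * (Real.sin φ : ℂ) = 1 := by
    have h := Real.cos_sq_add_sin_sq φ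
    rw [sq, sq] at h
    exact_mod_cast h
  have h1 (σ : Equiv.Perm Site) : permCLM (σ.symm * σ) = 1 := by
    rw [← permCLM_one]
    exact congrArg permCLM (inv_mul_cancel σ)
  have h2 (σ : Equiv.Perm Site) : permCLM (σ * σ.symm) = 1 := by
    rw [← permCLM_one]
    exact congrArg permCLM (mul_inv_cancel σ)
  have hs : star (scatteringOp φ) = (Real.cos φ : ℂ) • permCLM anticlockwise.symm
      - (Complex.I * (Real.sin φ : ℂ)) • permCLM clockwise.symm := by
    simp only [scatteringOp, star_add, star_smul, permCLM_star, star_mul', Complex.star_def,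
      Complex.conj_ofReal, Complex.conj_I, neg_mul, neg_smul, sub_eq_add_neg]
  have hmod (a b : ℂ) (C : L2Lattice →L[ℂ] L2Lattice) (hab : a * a + b * b = 1) :
      (a * a) • (1 : L2Lattice →L[ℂ] L2Lattice) - (Complex.I * b * a) • C
        + ((a * (Complex.I * b)) • C - (Complex.I * b * (Complex.I * b)) • 1) = 1 := by
    have e1 : Complex.I * b * (Complex.I * b) = - (b * b) := by
      linear_combination (b * b) * Complex.I_mul_I
    have e2 : Complex.I * b * a = a * (Complex.I * b) := by ring
    rw [e1, e2, neg_smul, sub_neg_eq_add, ← add_assoc, sub_add_cancel, ← add_smul, hab, one_smul]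
  rw [Unitary.mem_iff, hs]
  constructor
  · rw [scatteringOp]
    simp only [sub_mul, mul_add, smul_mul_smul_comm, permCLM_mul]
    rw [anticlockwise_symm_mul_clockwise, h1, h1]
    have := hmod _ _ (permCLM (clockwise.symm * anticlockwise)) hcs
    refine Eq.trans ?_ this
    abel
  · rw [scatteringOp]
    simp only [mul_sub, add_mul, smul_mul_smul_comm, permCLM_mul]
    rw [anticlockwise_mul_clockwise_symm, h2, h2]
    have := hmod _ _ (-permCLM (clockwise * anticlockwise.symm)) hcs
    simp only [smul_neg] at this
    refine Eq.trans ?_ this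
    abel

theorem networkOp_mem_unitary (φ : ℝ) (ω : Site → Circle) :
    networkOp φ ω ∈ unitary (L2Lattice →L[ℂ] L2Lattice) :=
  mul_mem (Unitary.linearIsometryEquiv.symm (phaseOp ω)).2 (scatteringOp_mem_unitary φ)

/-- Off the unit circle the operator `U_ω(φ) - z` is invertible. -/
theorem isUnit_networkOp_sub (φ : ℝ) (ω : Site → Circle) {z : ℂ} (hz : ‖z‖ ≠ 1) :
    IsUnit (networkOp φ ω - z • (1 : L2Lattice →L[ℂ] L2Lattice)) := by
  by_contra h
  apply hz
  have hmem : z ∈ spectrum ℂ (networkOp φ ω) := by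
    rw [spectrum.mem_iff, Algebra.algebraMap_eq_smul_one]
    intro h'
    apply h
    rw [← neg_sub]
    exact h'.neg
  simpa using spectrum.subset_circle_of_unitary (𝕜 := ℂ) (networkOp_mem_unitary φ ω) hmem

/-- The resolvent `R_ω(φ, z) = (U_ω(φ) - z)⁻¹`, an inverse in the algebra of bounded operators. -/
def networkResolvent (φ : ℝ) (ω : Site → Circle) (z : ℂ) : L2Lattice →L[ℂ] L2Lattice :=
  Ring.inverse (networkOp φ ω - z • (1 : L2Lattice →L[ℂ] L2Lattice))

/-- The Borel σ-algebra of the unit circle. -/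
instance Circle.instMeasurableSpaceBorel : MeasurableSpace Circle := borel Circle

instance Circle.instBorelSpace : BorelSpace Circle := ⟨rfl⟩

/-- The normalized Lebesgue measure (arc length divided by `2π`) on the unit circle. -/
def circleLaw : Measure Circle :=
  ENNReal.ofReal (2 * Real.pi)⁻¹ •
    (volume.restrict (Set.Ioc (-Real.pi) Real.pi)).map Circle.exp

instance circleLaw_isProbabilityMeasure : IsProbabilityMeasure circleLaw := by
  constructor
  rw [circleLaw, Measure.smul_apply,
    Measure.map_apply Circle.exp.continuous.measurable MeasurableSet.univ]
  have h : Real.pi - -Real.pi = 2 * Real.pi := by ring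
  rw [Set.preimage_univ, Measure.restrict_apply_univ, Real.volume_Ioc, h, smul_eq_mul,
    ← ENNReal.ofReal_mul (by positivity), inv_mul_cancel₀ (by positivity), ENNReal.ofReal_one]

/-- The law `ℙ` of the phases: the product over `ℤ²` of the normalized Lebesgue measure on the
circle, on the σ-algebra generated by the cylinder sets. -/
def phaseLaw : Measure (Site → Circle) := Measure.infinitePi fun _ => circleLaw

end

/-! This is the fractional moment method around the point $\varphi=0$, where $U_\omega$ splits into
independent $4\times4$ blocks, the cycles of `anticlockwise`. Solving the resolvent equation once
around the cycle through $x$ gives, for $y$ outside the block,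
$(z^4-\cos^4\varphi\,\omega_x\omega_{x_1}\omega_{x_2}\omega_{x_3})\,G(x,y)=O(\sin\varphi)$ times the
values of $G(\cdot,y)$ at four neighbouring sites (`networkGreen_block`). The factor on the left is
affine in $\omega_x$, so it is small only for exceptional values of that phase.

The values of $G$ on the right also depend on $\omega_x$. Since changing one phase is a rank one
perturbation, they are fractional linear in $\omega_x$ with a common denominator
(`exists_networkGreen_fractional_linear`). For exponents $p<1/2$ the moments of such functions can
be decoupled from the small factor (`fractional_moment_decoupling`). This yields
$f(x)\le\kappa\sum_k f(x^{(k)})$ for $f(x)=\mathbb E|G(x,y)|^p$, with $\kappa=O(|\varphi|^p)$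
uniformly in $z$.

Iteration needs a bound on $f$ uniform in $z$ (`integral_norm_networkGreen_rpow_le`). It comes from
rotating all phases together: diagonal matrix elements of $(1-\zeta wV)^{-1}$ are analytic in
$\zeta$ with positive real part, so Kolmogorov's inequality bounds every moment of order below $1$,
and polarization gives the rest.

Hence the moments of order $s/2$ decay exponentially when $\varphi$ is small. Interpolating with the
bounded moment of order $(1+s)/2<1$ gives decay at order $s$. -/

/-! ### Normalized Lebesgue measure on the circle. -/

theorem continuous_circle_coe : Continuous fun t : Circle => (t : ℂ) := by fun_prop

theorem circleLaw_eq_map_addCircle : haveI : Fact (0 < 2 * Real.pi) := ⟨Real.two_pi_pos⟩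
    circleLaw = ENNReal.ofReal (2 * Real.pi)⁻¹ •
      (volume : Measure (AddCircle (2 * Real.pi))).map AddCircle.toCircle := by
  have : Fact (0 < 2 * Real.pi) := ⟨Real.two_pi_pos⟩
  have h := (AddCircle.measurePreserving_mk (2 * Real.pi) (-Real.pi)).map_eq
  have e : -Real.pi + 2 * Real.pi = Real.pi := by ring
  rw [e] at h
  rw [circleLaw, ← h, Measure.map_map AddCircle.continuous_toCircle.measurable
    AddCircle.measurable_mk']
  congr 2
  ext θ
  simp [AddCircle.toCircle_apply_mk]

/-- Seen on `AddCircle`, rotations are translations and the measure is a multiple of Haar measure.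
-/
theorem circleLaw_map_mul (κ : Circle) : circleLaw.map (fun t => κ * t) = circleLaw := by
  have : Fact (0 < 2 * Real.pi) := ⟨Real.two_pi_pos⟩
  obtain ⟨a, rfl⟩ : ∃ a : AddCircle (2 * Real.pi), a.toCircle = κ := by
    obtain ⟨θ, rfl⟩ := Circle.exp_surjective κ
    refine ⟨(θ : AddCircle (2 * Real.pi)), ?_⟩
    rw [AddCircle.toCircle_apply_mk, div_self Real.two_pi_pos.ne', one_mul]
  rw [circleLaw_eq_map_addCircle, Measure.map_smul,
    Measure.map_map (continuous_const_mul _).measurable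
      AddCircle.continuous_toCircle.measurable]
  congr 1
  have : (fun t => a.toCircle * t) ∘ AddCircle.toCircle
      = AddCircle.toCircle ∘ fun x : AddCircle (2 * Real.pi) => a + x := by
    ext x; simp [AddCircle.toCircle_add]
  rw [this, ← Measure.map_map AddCircle.continuous_toCircle.measurable
    (measurable_const_add a), map_add_left_eq_self]

theorem measurePreserving_circle_mul (κ : Circle) :
    MeasurePreserving (fun t => κ * t) circleLaw circleLaw :=
  ⟨(continuous_const.mul continuous_id).measurable, circleLaw_map_mul κ⟩

theorem integral_circle_mul {E : Type*} [NormedAddCommGroup E] [NormedSpace ℝ E]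
    (κ : Circle) (f : Circle → E) :
    ∫ t, f (κ * t) ∂circleLaw = ∫ t, f t ∂circleLaw :=
  (measurePreserving_circle_mul κ).integral_comp
    (Homeomorph.mulLeft κ).measurableEmbedding f

theorem Continuous.integrable_circleLaw {E : Type*} [NormedAddCommGroup E]
    {f : Circle → E} (hf : Continuous f) : Integrable f circleLaw :=
  hf.integrable_of_hasCompactSupport (HasCompactSupport.of_compactSpace f)

theorem integral_circleLaw {E : Type*} [NormedAddCommGroup E] [NormedSpace ℝ E]
    {f : Circle → E} (hf : Continuous f) :
    ∫ t, f t ∂circleLaw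
      = (2 * Real.pi)⁻¹ • ∫ θ in (-Real.pi)..Real.pi, f (Circle.exp θ) := by
  rw [circleLaw, integral_smul_measure, ENNReal.toReal_ofReal (by positivity),
    integral_map Circle.exp.continuous.aemeasurable
      (hf.integrable_of_hasCompactSupport
        (HasCompactSupport.of_compactSpace f)).aestronglyMeasurable,
    intervalIntegral.integral_of_le (by linarith [Real.pi_pos])]

theorem integral_circleLaw_eq_circleAverage {E : Type*} [NormedAddCommGroup E] [NormedSpace ℝ E]
    {f : ℂ → E} (hf : ContinuousOn f (Metric.closedBall 0 1)) :
    ∫ t : Circle, f t ∂circleLaw = Real.circleAverage f 0 1 := by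
  have hc : Continuous fun t : Circle => f t :=
    hf.comp_continuous continuous_circle_coe fun t => by simp [Circle.norm_coe]
  rw [integral_circleLaw hc, Real.circleAverage_def]
  congr 1
  have hp : Function.Periodic (fun θ : ℝ => f (circleMap 0 1 θ)) (2 * Real.pi) := fun θ => by
    simp only [periodic_circleMap 0 1 θ]
  have := hp.intervalIntegral_add_eq (-Real.pi) 0
  have e : -Real.pi + 2 * Real.pi = Real.pi := by ring
  rw [e, zero_add] at this
  rw [← this]
  simp [circleMap, Circle.coe_exp]

theorem mean_value_circleLaw {f : ℂ → ℂ} {r : ℝ} (hr : 1 < r)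
    (hf : DifferentiableOn ℂ f (Metric.ball 0 r)) : ∫ t : Circle, f t ∂circleLaw = f 0 := by
  have hsub : Metric.closedBall (0 : ℂ) 1 ⊆ Metric.ball 0 r := Metric.closedBall_subset_ball hr
  rw [integral_circleLaw_eq_circleAverage (hf.continuousOn.mono hsub)]
  apply DiffContOnCl.circleAverage
  rw [abs_one]
  refine ⟨hf.mono (Metric.ball_subset_closedBall.trans hsub), ?_⟩
  rw [closure_ball _ one_ne_zero]
  exact hf.continuousOn.mono hsub

theorem ae_im_ne_zero_circleLaw : ∀ᵐ t : Circle ∂circleLaw, (t : ℂ).im ≠ 0 := by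
  have hm : MeasurableSet {t : Circle | (t : ℂ).im ≠ 0} :=
    ((Complex.continuous_im.comp continuous_circle_coe).isOpen_preimage _
      isOpen_compl_singleton).measurableSet
  rw [circleLaw]
  refine Measure.ae_smul_measure ?_ _
  rw [ae_map_iff Circle.exp.continuous.aemeasurable hm, ae_restrict_iff' measurableSet_Ioc]
  have : ∀ᵐ θ : ℝ, θ ∉ ({0, Real.pi} : Set ℝ) :=
    measure_eq_zero_iff_ae_notMem.1 ((Set.toFinite _).measure_zero _)
  filter_upwards [this] with θ hθ hI
  rw [Circle.coe_exp, Complex.exp_ofReal_mul_I_im]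
  intro h
  apply hθ
  by_cases h0 : θ = 0
  · exact Or.inl h0
  · by_cases hp : θ = Real.pi
    · exact Or.inr hp
    · exfalso
      rcases lt_or_gt_of_ne h0 with h1 | h1
      · exact absurd h (Real.sin_neg_of_neg_of_neg_pi_lt h1 hI.1).ne
      · exact absurd h (Real.sin_pos_of_pos_of_lt_pi h1 (lt_of_le_of_ne hI.2 hp)).ne'

theorem integrable_abs_im_rpow {p : ℝ} (hp1 : p < 1) (hp0 : 0 < p) :
    Integrable (fun t : Circle => |(t : ℂ).im| ^ (-p)) circleLaw := by
  have hmeas : Measurable fun t : Circle => |(t : ℂ).im| ^ (-p) :=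
    ((Complex.continuous_im.comp continuous_circle_coe).abs.measurable).pow_const _
  rw [circleLaw]
  refine Integrable.smul_measure ?_ ENNReal.ofReal_ne_top
  rw [integrable_map_measure hmeas.aestronglyMeasurable Circle.exp.continuous.aemeasurable]
  have hint : ∀ a : ℝ, Integrable (fun θ : ℝ => |θ - a| ^ (-p))
      (volume.restrict (Set.Ioc (-Real.pi) Real.pi)) := by
    intro a
    have h1 : IntervalIntegrable (fun θ : ℝ => |θ| ^ (-p)) volume (-Real.pi - a) (Real.pi - a) := by
      have hpos : ∀ c, 0 ≤ c → IntervalIntegrable (fun θ : ℝ => |θ| ^ (-p)) volume 0 c := by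
        intro c hc
        refine (intervalIntegral.intervalIntegrable_rpow' (r := -p) (by linarith)).congr ?_
        intro x hx
        rw [Set.uIoc_of_le hc] at hx
        simp only [abs_of_pos hx.1]
      have hall : ∀ c, IntervalIntegrable (fun θ : ℝ => |θ| ^ (-p)) volume 0 c := by
        intro c
        rcases le_total 0 c with hc | hc
        · exact hpos c hc
        · have := (hpos (-c) (by linarith)).comp_sub_left 0
          simpa using this
      exact (hall _).symm.trans (hall _)
    have h2 := h1.comp_sub_right a
    simp only [sub_add_cancel] at h2
    rwa [intervalIntegrable_iff_integrableOn_Ioc_of_le (by linarith [Real.pi_pos])] at h2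
  have hb := (((hint 0).add (hint Real.pi)).add (hint (-Real.pi))).const_mul ((2 / Real.pi) ^ (-p))
  refine hb.mono' ((hmeas.comp Circle.exp.continuous.measurable).aestronglyMeasurable) ?_
  rw [ae_restrict_iff' measurableSet_Ioc]
  have : ∀ᵐ θ : ℝ, θ ∉ ({0, Real.pi} : Set ℝ) :=
    measure_eq_zero_iff_ae_notMem.1 ((Set.toFinite _).measure_zero _)
  filter_upwards [this] with θ hθ hI
  have h0 : θ ≠ 0 := fun h => hθ (Or.inl h)
  have hπ : θ ≠ Real.pi := fun h => hθ (Or.inr h)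
  have hlt : θ < Real.pi := lt_of_le_of_ne hI.2 hπ
  have hgt : -Real.pi < θ := hI.1
  have hpp := Real.pi_pos
  simp only [Function.comp_apply, Circle.coe_exp, Complex.exp_ofReal_mul_I_im, Pi.add_apply,
    sub_zero, sub_neg_eq_add]
  rw [Real.norm_of_nonneg (by positivity)]
  have key : ∀ x : ℝ, 0 < |x| → 2 / Real.pi * |x| ≤ |Real.sin θ| →
      |Real.sin θ| ^ (-p) ≤ (2 / Real.pi) ^ (-p) * |x| ^ (-p) := by
    intro x hx h
    rw [← Real.mul_rpow (by positivity) hx.le]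
    exact Real.rpow_le_rpow_of_nonpos (by positivity) h (by linarith)
  have n1 : 0 ≤ |θ| ^ (-p) := by positivity
  have n2 : 0 ≤ |θ - Real.pi| ^ (-p) := by positivity
  have n3 : 0 ≤ |θ + Real.pi| ^ (-p) := by positivity
  -- The point $x$ is the displacement of $\theta$ from the nearest zero of the sine among
  -- $0,\pm\pi$. It satisfies $|x|\le\pi/2$, so Jordan's inequality applies; the dominating function
  -- adds the singularities at all three zeros.
  have fin : ∃ x, (x = θ ∨ x = θ - Real.pi ∨ x = θ + Real.pi) ∧ 0 < |x| ∧
      2 / Real.pi * |x| ≤ |Real.sin θ| := by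
    by_cases hs : |θ| ≤ Real.pi / 2
    · exact ⟨θ, Or.inl rfl, abs_pos.2 h0, Real.mul_abs_le_abs_sin hs⟩
    · rw [not_le, lt_abs] at hs
      rcases hs with hs | hs
      · refine ⟨θ - Real.pi, Or.inr (Or.inl rfl), abs_pos.2 (sub_ne_zero.2 hπ), ?_⟩
        have := Real.mul_abs_le_abs_sin (x := θ - Real.pi) (abs_le.2 ⟨by linarith, by linarith⟩)
        rwa [Real.sin_sub_pi, abs_neg] at this
      · refine ⟨θ + Real.pi, Or.inr (Or.inr rfl), abs_pos.2 (by linarith), ?_⟩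
        have := Real.mul_abs_le_abs_sin (x := θ + Real.pi) (abs_le.2 ⟨by linarith, by linarith⟩)
        rwa [Real.sin_add_pi, abs_neg] at this
  obtain ⟨x, hx, hx0, hxs⟩ := fin
  refine (key x hx0 hxs).trans (mul_le_mul_of_nonneg_left ?_ (by positivity))
  rcases hx with rfl | rfl | rfl <;> linarith

/-! ### Rotation invariance of the law of the phases. -/

theorem phaseLaw_map_mul (τ : Site → Circle) : phaseLaw.map (fun ω => τ * ω) = phaseLaw := by
  rw [phaseLaw]
  have := Measure.infinitePi_map_pi (μ := fun _ : Site => circleLaw)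
    (f := fun μ t => τ μ * t) fun i => (continuous_const.mul continuous_id).measurable
  simp only [circleLaw_map_mul] at this
  exact this

instance : IsProbabilityMeasure phaseLaw := by rw [phaseLaw]; infer_instance

theorem Continuous.integrable_phaseLaw {f : (Site → Circle) → ℝ} (hf : Continuous f) {B : ℝ}
    (hB : ∀ ω, |f ω| ≤ B) : Integrable f phaseLaw :=
  Integrable.of_bound hf.measurable.aestronglyMeasurable B (ae_of_all _ hB)

/-- Averaging over a family of rotations of the phases does not change the expectation. -/
theorem integral_phaseLaw_eq_average {f : (Site → Circle) → ℝ} (hf : Continuous f) {B : ℝ}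
    (hB : ∀ ω, |f ω| ≤ B) {τ : Circle → Site → Circle} (hτ : Continuous τ) :
    Integrable (fun ω => ∫ t, f (τ t * ω) ∂circleLaw) phaseLaw ∧
    ∫ ω, f ω ∂phaseLaw = ∫ ω, ∫ t, f (τ t * ω) ∂circleLaw ∂phaseLaw := by
  have hc : Continuous fun q : (Site → Circle) × Circle => f (τ q.2 * q.1) :=
    hf.comp ((hτ.comp continuous_snd).mul continuous_fst)
  have hi : Integrable (fun q : (Site → Circle) × Circle => f (τ q.2 * q.1))
      (phaseLaw.prod circleLaw) :=
    Integrable.of_bound hc.measurable.aestronglyMeasurable B (ae_of_all _ fun _ => hB _)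
  refine ⟨hi.integral_prod_left, ?_⟩
  rw [integral_integral_swap hi]
  -- After Fubini, invariance under each fixed rotation makes the inner integral independent of $t$.
  have : ∀ t, ∫ ω, f (τ t * ω) ∂phaseLaw = ∫ ω, f ω ∂phaseLaw := by
    intro t
    conv_rhs => rw [← phaseLaw_map_mul (τ t)]
    exact (integral_map (continuous_const.mul continuous_id).measurable.aemeasurable
      hf.measurable.aestronglyMeasurable).symm
  simp [this]

/-! ### Affine and fractional linear functions on the circle: decoupling. -/

/-- Multiplying $\gamma+t\delta$ by $\bar\gamma$, or by $\overline{t\delta}$, makes one of the two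
terms real. The imaginary part of the other is $\pm|\gamma||\delta|\operatorname{Im}(\kappa t)$,
where $\kappa$ is the phase of $\delta\bar\gamma$. The two resulting bounds are averaged. -/
theorem exists_norm_add_mul_ge (γ δ : ℂ) : ∃ κ : Circle, ∀ t : Circle,
    (‖γ‖ + ‖δ‖) / 2 * |((κ * t : Circle) : ℂ).im| ≤ ‖γ + t * δ‖ := by
  have hle : ∀ t : Circle, |(t : ℂ).im| ≤ 1 := fun t =>
    (Complex.abs_im_le_norm _).trans (Circle.norm_coe t).le
  by_cases h0 : γ = 0 ∨ δ = 0
  · refine ⟨1, fun t => ?_⟩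
    have h1 := hle (1 * t)
    have hn : ‖γ + t * δ‖ = ‖γ‖ + ‖δ‖ := by
      rcases h0 with rfl | rfl <;> simp [Circle.norm_coe]
    rw [hn]
    nlinarith [norm_nonneg γ, norm_nonneg δ, abs_nonneg ((1 * t : Circle) : ℂ).im]
  · push Not at h0
    have hγ := norm_pos_iff.2 h0.1
    have hδ := norm_pos_iff.2 h0.2
    set x : ℂ := δ * starRingEnd ℂ γ with hx
    refine ⟨Circle.exp x.arg, fun t => ?_⟩
    have hkey : ‖γ‖ * ‖δ‖ * |((Circle.exp x.arg * t : Circle) : ℂ).im| = |(x * t).im| := by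
      conv_rhs => rw [← Complex.norm_mul_exp_arg_mul_I x]
      rw [Circle.coe_mul, Circle.coe_exp, mul_assoc (‖x‖ : ℂ), Complex.im_ofReal_mul, abs_mul, abs_norm, hx,
        norm_mul, Complex.norm_conj, mul_comm ‖γ‖]
    have h1 : |(x * t).im| ≤ ‖γ + t * δ‖ * ‖γ‖ := by
      have e : (x * t).im = ((γ + t * δ) * starRingEnd ℂ γ).im := by
        rw [add_mul, Complex.add_im, Complex.mul_conj, Complex.ofReal_im, zero_add, hx]
        congr 1; ring
      rw [e, ← Complex.norm_conj γ, ← norm_mul]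
      exact Complex.abs_im_le_norm _
    have h2 : |(x * t).im| ≤ ‖γ + t * δ‖ * ‖δ‖ := by
      have e : (x * t).im = -((γ + t * δ) * starRingEnd ℂ (t * δ)).im := by
        rw [add_mul, Complex.add_im, Complex.mul_conj, Complex.ofReal_im, add_zero, ← Complex.conj_im,
          hx]
        congr 1
        simp only [map_mul, Complex.conj_conj]
        ring
      have e2 : ‖δ‖ = ‖starRingEnd ℂ (t * δ)‖ := by
        rw [Complex.norm_conj, norm_mul, Circle.norm_coe, one_mul]
      rw [e, abs_neg, e2, ← norm_mul]
      exact Complex.abs_im_le_norm _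
    set I := |((Circle.exp x.arg * t : Circle) : ℂ).im|
    have h3 : ‖δ‖ * I ≤ ‖γ + t * δ‖ := by
      refine le_of_mul_le_mul_right ?_ hγ
      linarith
    have h4 : ‖γ‖ * I ≤ ‖γ + t * δ‖ := by
      refine le_of_mul_le_mul_right ?_ hδ
      linarith
    linarith

/-- The points $t$ and $-t$ are paired: $|\alpha+t\beta|+|\alpha-t\beta|$ is at least $2|\alpha|$
and at least $2|\beta|$, and $x\mapsto x^p$ is subadditive. -/
theorem half_rpow_le_integral {p : ℝ} (hp0 : 0 < p) (hp1 : p ≤ 1) (α β : ℂ) :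
    (‖α‖ + ‖β‖) ^ p / 2 ≤ ∫ t : Circle, ‖α + t * β‖ ^ p ∂circleLaw := by
  have hc : Continuous fun t : Circle => ‖α + t * β‖ ^ p :=
    (continuous_const.add (continuous_circle_coe.mul continuous_const)).norm.rpow_const
      fun _ => Or.inr hp0.le
  have hneg : ∫ t : Circle, ‖α - t * β‖ ^ p ∂circleLaw = ∫ t : Circle, ‖α + t * β‖ ^ p ∂circleLaw := by
    rw [← integral_circle_mul (-1)]
    simp [sub_eq_add_neg]
  have hc' : Continuous fun t : Circle => ‖α - t * β‖ ^ p :=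
    (continuous_const.sub (continuous_circle_coe.mul continuous_const)).norm.rpow_const
      fun _ => Or.inr hp0.le
  have hpt : ∀ t : Circle, (‖α‖ + ‖β‖) ^ p ≤ ‖α + t * β‖ ^ p + ‖α - t * β‖ ^ p := by
    intro t
    refine le_trans ?_ (Real.rpow_add_le_add_rpow (norm_nonneg _) (norm_nonneg _) hp0.le hp1)
    refine Real.rpow_le_rpow (by positivity) ?_ hp0.le
    have h1 := norm_add_le (α + t * β) (α - t * β)
    have h2 := norm_sub_le (α + t * β) (α - t * β)
    have e1 : α + t * β + (α - t * β) = 2 * α := by ring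
    have e2 : α + t * β - (α - t * β) = 2 * (t * β) := by ring
    rw [e1, norm_mul] at h1
    rw [e2, norm_mul, norm_mul, Circle.norm_coe] at h2
    norm_num at h1 h2
    linarith
  have := integral_mono (μ := circleLaw) (integrable_const _)
    (hc.integrable_circleLaw.add hc'.integrable_circleLaw) hpt
  simp only [Pi.add_apply] at this
  rw [integral_add hc.integrable_circleLaw hc'.integrable_circleLaw, hneg] at this
  simp at this
  linarith

theorem Real.sum_rpow_le {ι : Type*} (s : Finset ι) {f : ι → ℝ} (hf : ∀ i, 0 ≤ f i) {p : ℝ}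
    (hp0 : 0 < p) (hp1 : p ≤ 1) : (∑ i ∈ s, f i) ^ p ≤ ∑ i ∈ s, f i ^ p := by
  classical
  induction s using Finset.induction_on with
  | empty => simp [Real.zero_rpow hp0.ne']
  | insert a s ha ih =>
    rw [Finset.sum_insert ha, Finset.sum_insert ha]
    exact (Real.rpow_add_le_add_rpow (hf a) (Finset.sum_nonneg fun i _ => hf i) hp0.le hp1).trans
      (by gcongr)

/-- The decoupling inequality for fractional moments of fractional linear functions on the
circle. -/
theorem fractional_moment_decoupling {p : ℝ} (hp0 : 0 < p) (hp1 : 2 * p < 1) :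
    ∃ K : ℝ, 0 < K ∧ ∀ (r : Circle → ℂ) (q : Fin 4 → Circle → ℂ) (γ₀ δ₀ γ₁ δ₁ : ℂ)
      (α β : Fin 4 → ℂ) (ε : ℝ), Continuous r → (∀ k, Continuous (q k)) → 0 ≤ ε →
      0 < ‖γ₀‖ + ‖δ₀‖ → 0 < ‖γ₁‖ + ‖δ₁‖ →
      (∀ k t, (γ₁ + t * δ₁) * q k t = α k + t * β k) →
      (∀ t : Circle, ‖γ₀ + t * δ₀‖ * ‖r t‖ ≤ ε * ∑ k, ‖q k t‖) →
      ∫ t, ‖r t‖ ^ p ∂circleLaw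
        ≤ K * (ε / (‖γ₀‖ + ‖δ₀‖)) ^ p * ∑ k, ∫ t, ‖q k t‖ ^ p ∂circleLaw := by
  set J : ℝ := ∫ t : Circle, |(t : ℂ).im| ^ (-(2 * p)) ∂circleLaw with hJ
  have hJ0 : 0 ≤ J := integral_nonneg fun t => by positivity
  -- The $4^p$ collects the factors $1/2$ of the two lower bounds for affine functions, the $2$ is
  -- the one in `half_rpow_le_integral`, and the $+1$ only ensures positivity.
  refine ⟨2 * 4 ^ p * J + 1, by positivity, ?_⟩
  intro r q γ₀ δ₀ γ₁ δ₁ α β ε hr hq hε hN0 hN1 hqe hre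
  obtain ⟨κ₀, hκ₀⟩ := exists_norm_add_mul_ge γ₀ δ₀
  obtain ⟨κ₁, hκ₁⟩ := exists_norm_add_mul_ge γ₁ δ₁
  set N₀ := ‖γ₀‖ + ‖δ₀‖ with hN₀
  set N₁ := ‖γ₁‖ + ‖δ₁‖ with hN₁
  let M : Fin 4 → ℝ := fun k => ‖α k‖ + ‖β k‖
  have hM : ∀ k, 0 ≤ M k := fun k => by positivity
  have hae : ∀ κ : Circle, ∀ᵐ t : Circle ∂circleLaw, ((κ * t : Circle) : ℂ).im ≠ 0 := fun κ =>
    (measurePreserving_circle_mul κ).quasiMeasurePreserving.ae ae_im_ne_zero_circleLaw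
  have hint : ∀ κ : Circle, Integrable
      (fun t : Circle => |((κ * t : Circle) : ℂ).im| ^ (-(2 * p))) circleLaw := fun κ =>
    (measurePreserving_circle_mul κ).integrable_comp_of_integrable
      (integrable_abs_im_rpow hp1 (by linarith))
  have hval : ∀ κ : Circle,
      ∫ t : Circle, |((κ * t : Circle) : ℂ).im| ^ (-(2 * p)) ∂circleLaw = J := fun κ =>
    integral_circle_mul κ fun t : Circle => |(t : ℂ).im| ^ (-(2 * p))
  -- The denominator is at most $N_1$ on the circle, so the moment of $q_k$ is bounded below by its
  -- coefficients. The same power of $N_1$ appears in `hup` and cancels.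
  have hlow : ∀ k, N₁ ^ (-p) * (M k ^ p / 2) ≤ ∫ t, ‖q k t‖ ^ p ∂circleLaw := by
    intro k
    refine (mul_le_mul_of_nonneg_left (half_rpow_le_integral hp0 (by linarith) (α k) (β k))
      (by positivity)).trans ?_
    rw [← integral_const_mul]
    refine integral_mono_of_nonneg (ae_of_all _ fun t => by positivity)
      (((hq k).norm.rpow_const fun _ => Or.inr hp0.le).integrable_circleLaw)
      (ae_of_all _ fun t => ?_)
    simp only
    rw [← hqe k t, norm_mul, Real.mul_rpow (norm_nonneg _) (norm_nonneg _), ← mul_assoc]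
    refine mul_le_of_le_one_left (by positivity) ?_
    rw [Real.rpow_neg hN1.le, inv_mul_le_one₀ (by positivity)]
    refine Real.rpow_le_rpow (norm_nonneg _) ((norm_add_le _ _).trans ?_) hp0.le
    rw [norm_mul, Circle.norm_coe, one_mul]
  have hup : ∀ᵐ t : Circle ∂circleLaw, ‖r t‖ ^ p ≤ (4 * ε / (N₀ * N₁)) ^ p * (∑ k, M k ^ p) *
      ((|((κ₀ * t : Circle) : ℂ).im| ^ (-(2 * p)) + |((κ₁ * t : Circle) : ℂ).im| ^ (-(2 * p))) / 2) := by
    filter_upwards [hae κ₀, hae κ₁] with t h0 h1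
    have hI0 := abs_pos.2 h0
    have hI1 := abs_pos.2 h1
    have hk0 := hκ₀ t
    have hk1 := hκ₁ t
    set I₀ := |((κ₀ * t : Circle) : ℂ).im|
    set I₁ := |((κ₁ * t : Circle) : ℂ).im|
    have hqk : ∀ k, ‖q k t‖ ≤ 2 / (N₁ * I₁) * M k := by
      intro k
      have h2 : N₁ / 2 * I₁ * ‖q k t‖ ≤ M k := by
        refine (mul_le_mul_of_nonneg_right hk1 (norm_nonneg _)).trans ?_
        rw [← norm_mul, hqe k t]
        refine (norm_add_le _ _).trans ?_
        rw [norm_mul, Circle.norm_coe, one_mul]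
      rw [div_mul_eq_mul_div, le_div_iff₀ (by positivity)]
      linarith
    have hrt : ‖r t‖ ≤ 4 * ε / (N₀ * N₁) * (∑ k, M k) * (I₀⁻¹ * I₁⁻¹) := by
      have h3 : N₀ / 2 * I₀ * ‖r t‖ ≤ ε * (2 / (N₁ * I₁) * ∑ k, M k) := by
        refine (mul_le_mul_of_nonneg_right hk0 (norm_nonneg _)).trans ((hre t).trans ?_)
        rw [Finset.mul_sum Finset.univ M (2 / (N₁ * I₁))]
        exact mul_le_mul_of_nonneg_left (Finset.sum_le_sum fun k _ => hqk k) hε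
      have h4 : ‖r t‖ ≤ ε * (2 / (N₁ * I₁) * ∑ k, M k) / (N₀ / 2 * I₀) := by
        rw [le_div_iff₀ (by positivity)]; linarith
      refine h4.trans (le_of_eq ?_)
      field_simp
      ring
    have hS : 0 ≤ ∑ k, M k := Finset.sum_nonneg fun k _ => hM k
    refine (Real.rpow_le_rpow (norm_nonneg _) hrt hp0.le).trans ?_
    rw [Real.mul_rpow (by positivity) (by positivity), Real.mul_rpow (by positivity) hS]
    -- The two singularities may coincide, so their product is split into squares. This is where
    -- $2p<1$ is needed: $|\operatorname{Im}t|^{-2p}$ must be integrable.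
    have hyoung : (I₀⁻¹ * I₁⁻¹) ^ p ≤ (I₀ ^ (-(2 * p)) + I₁ ^ (-(2 * p))) / 2 := by
      rw [Real.mul_rpow (by positivity) (by positivity)]
      have e : ∀ x : ℝ, 0 < x → x ^ (-(2 * p)) = (x⁻¹ ^ p) ^ 2 := fun x hx => by
        rw [← Real.rpow_natCast, ← Real.rpow_mul (by positivity), Real.inv_rpow hx.le,
          ← Real.rpow_neg hx.le]
        congr 1; push_cast; ring
      rw [e _ hI0, e _ hI1]
      nlinarith [sq_nonneg (I₀⁻¹ ^ p - I₁⁻¹ ^ p)]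
    have hsum := Real.sum_rpow_le Finset.univ hM hp0 (show p ≤ 1 by linarith)
    gcongr
  have hmain := integral_mono_of_nonneg (ae_of_all _ fun t => by positivity)
    ((((hint κ₀).add (hint κ₁)).div_const 2).const_mul _) hup
  rw [integral_const_mul, integral_div, integral_add' (hint κ₀) (hint κ₁), hval, hval] at hmain
  refine hmain.trans ?_
  have hsl : N₁ ^ (-p) * ∑ k, M k ^ p ≤ 2 * ∑ k, ∫ t, ‖q k t‖ ^ p ∂circleLaw := by
    rw [Finset.mul_sum, Finset.mul_sum]
    exact Finset.sum_le_sum fun k _ => by linarith [hlow k]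
  have hfac : (4 * ε / (N₀ * N₁)) ^ p = 4 ^ p * (ε / N₀) ^ p * N₁ ^ (-p) := by
    rw [show 4 * ε / (N₀ * N₁) = 4 * (ε / N₀) * N₁⁻¹ by field_simp,
      Real.mul_rpow (by positivity) (by positivity), Real.mul_rpow (by positivity) (by positivity),
      Real.inv_rpow hN1.le, Real.rpow_neg hN1.le]
  rw [hfac]
  set Q := ∑ k, ∫ t, ‖q k t‖ ^ p ∂circleLaw
  have hQ : 0 ≤ Q := Finset.sum_nonneg fun k _ => integral_nonneg fun t => by positivity
  have hA : 0 ≤ 4 ^ p * (ε / N₀) ^ p * J := by positivity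
  have h5 := mul_le_mul_of_nonneg_left hsl hA
  have hE : 0 ≤ (ε / N₀) ^ p * Q := by positivity
  nlinarith

/-! ### Kolmogorov's inequality. -/

/-- In the right half plane $|\arg x|<\pi/2$, so $|\arg x^p|<\pi p/2<\pi/2$. -/
theorem re_cpow_ge {x : ℂ} (hx : 0 < x.re) {p : ℝ} (hp0 : 0 < p) (hp1 : p < 1) :
    Real.cos (Real.pi * p / 2) * ‖x‖ ^ p ≤ (x ^ (p : ℂ)).re := by
  have hx0 : x ≠ 0 := fun h => by simp [h] at hx
  rw [Complex.cpow_def_of_ne_zero hx0, Complex.exp_re, Complex.re_mul_ofReal,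
    Complex.im_mul_ofReal, Complex.log_re, Complex.log_im,
    ← Real.rpow_def_of_pos (norm_pos_iff.2 hx0), mul_comm]
  refine mul_le_mul_of_nonneg_left ?_ (by positivity)
  rw [← Real.cos_abs (x.arg * p)]
  have harg := Complex.abs_arg_lt_pi_div_two_iff.2 (Or.inl hx)
  refine Real.cos_le_cos_of_nonneg_of_le_pi (abs_nonneg _) ?_ ?_
  · nlinarith [Real.pi_pos]
  · rw [abs_mul, abs_of_pos hp0]
    nlinarith

/-- Kolmogorov's inequality for the fractional moments of an analytic function with positive real
part. -/
theorem integral_norm_rpow_le_of_re_pos {H : ℂ → ℂ} {r : ℝ} (hr : 1 < r)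
    (hH : DifferentiableOn ℂ H (Metric.ball 0 r)) (hpos : ∀ ζ ∈ Metric.ball 0 r, 0 < (H ζ).re)
    {p : ℝ} (hp0 : 0 < p) (hp1 : p < 1) :
    ∫ t : Circle, ‖H t‖ ^ p ∂circleLaw ≤ ‖H 0‖ ^ p / Real.cos (Real.pi * p / 2) := by
  have hcos : 0 < Real.cos (Real.pi * p / 2) :=
    Real.cos_pos_of_mem_Ioo ⟨by nlinarith [Real.pi_pos], by nlinarith [Real.pi_pos]⟩
  have hmem : ∀ t : Circle, (t : ℂ) ∈ Metric.ball (0 : ℂ) r := fun t => by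
    rw [mem_ball_zero_iff, Circle.norm_coe]; exact hr
  have hd : DifferentiableOn ℂ (fun ζ => H ζ ^ (p : ℂ)) (Metric.ball 0 r) := fun ζ hζ =>
    (hH ζ hζ).cpow (differentiableWithinAt_const _) (Or.inl (hpos ζ hζ))
  -- The principal branch of $H^p$ is analytic because $H$ stays in the right half plane. Its mean
  -- over the circle is $H(0)^p$, and its real part controls $|H|^p$.
  have hmv := mean_value_circleLaw hr hd
  have hc : Continuous fun t : Circle => H t :=
    hH.continuousOn.comp_continuous continuous_circle_coe hmem
  have hcp : Continuous fun t : Circle => H t ^ (p : ℂ) :=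
    hd.continuousOn.comp_continuous continuous_circle_coe hmem
  rw [le_div_iff₀ hcos, mul_comm, ← integral_const_mul]
  calc _ ≤ ∫ t : Circle, (H t ^ (p : ℂ)).re ∂circleLaw :=
        integral_mono (((hc.norm.rpow_const fun _ => Or.inr hp0.le).integrable_circleLaw).const_mul _)
          (Complex.continuous_re.comp hcp).integrable_circleLaw
          fun t => re_cpow_ge (hpos _ (hmem t)) hp0 hp1
    _ = (H 0 ^ (p : ℂ)).re := by
        rw [← hmv]
        exact integral_re hcp.integrable_circleLaw
    _ ≤ ‖H 0 ^ (p : ℂ)‖ := Complex.re_le_norm _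
    _ = ‖H 0‖ ^ p := by
        rw [Complex.norm_cpow_real]

/-! ### Fractional moments of the resolvent of a contraction. -/

section Resolvent
variable {E : Type*} [NormedAddCommGroup E] [InnerProductSpace ℂ E] [CompleteSpace E]

theorem differentiableAt_inverse_one_sub_smul (V : E →L[ℂ] E) (w : ℂ) {ζ : ℂ}
    (h : ‖(ζ * w) • V‖ < 1) :
    DifferentiableAt ℂ (fun ζ : ℂ => Ring.inverse (1 - (ζ * w) • V)) ζ := by
  have hu : IsUnit (1 - (ζ * w) • V) := isUnit_one_sub_of_norm_lt_one h
  have h1 : DifferentiableAt ℂ (Ring.inverse : (E →L[ℂ] E) → _) (1 - (ζ * w) • V) := by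
    obtain ⟨u, hu⟩ := hu
    rw [← hu]
    exact differentiableAt_inverse u.isUnit
  have h2 : DifferentiableAt ℂ (fun ζ : ℂ => 1 - (ζ * w) • V) ζ := by fun_prop
  exact DifferentiableAt.comp (g := Ring.inverse) ζ h1 h2

/-- The radius $2/(1+|w|)$ exceeds $1$ and is below $1/|w|$ if $w\ne0$: the disc contains the closed
unit disc, and the Neumann series converges on it. -/
theorem norm_smul_lt_one {V : E →L[ℂ] E} (hV : ‖V‖ ≤ 1) {w ζ : ℂ} (hw : ‖w‖ < 1)
    (hζ : ζ ∈ Metric.ball (0 : ℂ) (2 / (1 + ‖w‖))) : ‖(ζ * w) • V‖ < 1 := by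
  rw [mem_ball_zero_iff, lt_div_iff₀ (by positivity)] at hζ
  rw [norm_smul, norm_mul]
  refine lt_of_le_of_lt (mul_le_of_le_one_right (by positivity) hV) ?_
  rcases (norm_nonneg w).eq_or_lt with h | h
  · simp [← h]
  · nlinarith [norm_nonneg ζ]

/-- With $T=\zeta wV$ and $\psi=(1-T)^{-1}a$, the matrix element equals
$\langle(1-T)\psi,\psi\rangle$. Its real part is at least $(1-\|T\|)\|\psi\|^2>0$, so Kolmogorov's
inequality applies, with value $\|a\|^2$ at $\zeta=0$. -/
theorem fractional_moment_quadratic {V : E →L[ℂ] E} (hV : ‖V‖ ≤ 1) {w : ℂ} (hw : ‖w‖ < 1) (a : E)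
    {p : ℝ} (hp0 : 0 < p) (hp1 : p < 1) :
    ∫ t : Circle, ‖inner ℂ a (Ring.inverse (1 - ((t : ℂ) * w) • V) a)‖ ^ p ∂circleLaw
      ≤ (‖a‖ ^ 2) ^ p / Real.cos (Real.pi * p / 2) := by
  rcases eq_or_ne a 0 with rfl | ha
  · simp [Real.zero_rpow hp0.ne']
  have hr : 1 < 2 / (1 + ‖w‖) := by
    rw [lt_div_iff₀ (by positivity)]; linarith
  have h := integral_norm_rpow_le_of_re_pos
    (H := fun ζ => inner ℂ a (Ring.inverse (1 - (ζ * w) • V) a)) hr ?_ ?_ hp0 hp1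
  · refine h.trans (le_of_eq ?_)
    simp [inner_self_eq_norm_sq_to_K]
  · intro ζ hζ
    have := differentiableAt_inverse_one_sub_smul V w (norm_smul_lt_one hV hw hζ)
    exact ((innerSL ℂ a).differentiableAt.comp ζ
      (this.clm_apply (differentiableAt_const a))).differentiableWithinAt
  · intro ζ hζ
    have hlt := norm_smul_lt_one hV hw hζ
    have hu : IsUnit (1 - (ζ * w) • V) := isUnit_one_sub_of_norm_lt_one hlt
    set T := (ζ * w) • V
    set ψ := Ring.inverse (1 - T) a with hψ
    have e : (1 - T) ψ = a := by
      have := congrArg (fun A : E →L[ℂ] E => A a) (Ring.mul_inverse_cancel _ hu)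
      simpa using this
    have e' : a = ψ - T ψ := by rw [← e]; simp
    have hψ0 : ψ ≠ 0 := fun h => ha (by rw [e', h]; simp)
    rw [e', inner_sub_left, Complex.sub_re]
    have h1 : (inner ℂ (T ψ) ψ).re ≤ ‖T‖ * ‖ψ‖ * ‖ψ‖ :=
      (Complex.re_le_norm _).trans ((norm_inner_le_norm _ _).trans
        (mul_le_mul_of_nonneg_right (T.le_opNorm ψ) (norm_nonneg _)))
    have h2 : (inner ℂ ψ ψ).re = ‖ψ‖ * ‖ψ‖ := by
      rw [← sq]; exact inner_self_eq_norm_sq (𝕜 := ℂ) ψ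
    rw [h2]
    nlinarith [mul_pos (norm_pos_iff.2 hψ0) (norm_pos_iff.2 hψ0)]

theorem continuous_inverse_one_sub_smul {V : E →L[ℂ] E} (hV : ‖V‖ ≤ 1) {w : ℂ} (hw : ‖w‖ < 1) :
    Continuous fun t : Circle => Ring.inverse (1 - ((t : ℂ) * w) • V) := by
  have hr : 1 < 2 / (1 + ‖w‖) := by
    rw [lt_div_iff₀ (by positivity)]; linarith
  have : ContinuousOn (fun ζ : ℂ => Ring.inverse (1 - (ζ * w) • V))
      (Metric.ball 0 (2 / (1 + ‖w‖))) := fun ζ hζ =>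
    (differentiableAt_inverse_one_sub_smul V w
      (norm_smul_lt_one hV hw hζ)).continuousAt.continuousWithinAt
  refine this.comp_continuous continuous_circle_coe fun t => ?_
  rw [mem_ball_zero_iff, Circle.norm_coe]; exact hr

theorem fractional_moment_inner {V : E →L[ℂ] E} (hV : ‖V‖ ≤ 1) {w : ℂ} (hw : ‖w‖ < 1) {a b : E}
    (ha : ‖a‖ ≤ 1) (hb : ‖b‖ ≤ 1) {p : ℝ} (hp0 : 0 < p) (hp1 : p < 1) :
    ∫ t : Circle, ‖inner ℂ a (Ring.inverse (1 - ((t : ℂ) * w) • V) b)‖ ^ p ∂circleLaw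
      ≤ 4 * (4 ^ p / Real.cos (Real.pi * p / 2)) := by
  have hcos : 0 < Real.cos (Real.pi * p / 2) :=
    Real.cos_pos_of_mem_Ioo ⟨by nlinarith [Real.pi_pos], by nlinarith [Real.pi_pos]⟩
  -- The four vectors of the polarization identity. Each has norm at most $2$, whence $4^p$; the
  -- factor $1/4$ of the identity is dropped.
  let c : Fin 4 → E := ![a + b, a - b, a + Complex.I • b, a - Complex.I • b]
  have hc : ∀ k, ‖c k‖ ≤ 2 := by
    have h1 := norm_add_le a b
    have h2 := norm_sub_le a b
    have h3 := norm_add_le a (Complex.I • b)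
    have h4 := norm_sub_le a (Complex.I • b)
    rw [norm_smul, Complex.norm_I, one_mul] at h3 h4
    intro k
    fin_cases k
    · exact h1.trans (by linarith)
    · exact h2.trans (by linarith)
    · exact h3.trans (by linarith)
    · exact h4.trans (by linarith)
  let A : Circle → E →L[ℂ] E := fun t => Ring.inverse (1 - ((t : ℂ) * w) • V)
  have hA : Continuous A := continuous_inverse_one_sub_smul hV hw
  have hcont : ∀ a b : E, Continuous fun t => ‖inner ℂ a (A t b)‖ ^ p := fun a b =>
    (continuous_const.inner (hA.clm_apply continuous_const)).norm.rpow_const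
      fun _ => Or.inr hp0.le
  have hpt : ∀ t, ‖inner ℂ a (A t b)‖ ^ p ≤ ∑ k, ‖inner ℂ (c k) (A t (c k))‖ ^ p := by
    intro t
    refine le_trans ?_ (Real.sum_rpow_le _ (fun k => norm_nonneg _) hp0 hp1.le)
    refine Real.rpow_le_rpow (norm_nonneg _) ?_ hp0.le
    have hpol := inner_map_polarization (A t).toLinearMap a b
    simp only [ContinuousLinearMap.coe_coe] at hpol
    rw [norm_inner_symm, hpol, norm_div, Fin.sum_univ_four]
    simp only [c, Matrix.cons_val]
    rw [norm_inner_symm (a + b), norm_inner_symm (a - b), norm_inner_symm (a + Complex.I • b),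
      norm_inner_symm (a - Complex.I • b)]
    set x₁ := inner ℂ (A t (a + b)) (a + b)
    set x₂ := inner ℂ (A t (a - b)) (a - b)
    set x₃ := inner ℂ (A t (a + Complex.I • b)) (a + Complex.I • b)
    set x₄ := inner ℂ (A t (a - Complex.I • b)) (a - Complex.I • b)
    have h1 := norm_sub_le (x₁ - x₂ + Complex.I * x₃) (Complex.I * x₄)
    have h2 := norm_add_le (x₁ - x₂) (Complex.I * x₃)
    have h3 := norm_sub_le x₁ x₂
    rw [norm_mul, Complex.norm_I, one_mul] at h1 h2
    have h4 : ‖(4 : ℂ)‖ = 4 := by norm_num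
    rw [h4, div_le_iff₀ (by norm_num)]
    linarith [norm_nonneg x₁, norm_nonneg x₂, norm_nonneg x₃, norm_nonneg x₄]
  calc _ ≤ ∫ t, ∑ k, ‖inner ℂ (c k) (A t (c k))‖ ^ p ∂circleLaw :=
        integral_mono (hcont a b).integrable_circleLaw
          (continuous_finsetSum _ fun k _ => hcont _ _).integrable_circleLaw hpt
    _ = ∑ k, ∫ t, ‖inner ℂ (c k) (A t (c k))‖ ^ p ∂circleLaw :=
        integral_finsetSum _ fun k _ => (hcont _ _).integrable_circleLaw
    _ ≤ ∑ k : Fin 4, 4 ^ p / Real.cos (Real.pi * p / 2) := by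
        refine Finset.sum_le_sum fun k _ => (fractional_moment_quadratic hV hw (c k) hp0 hp1).trans ?_
        have : ‖c k‖ ^ 2 ≤ 4 := by nlinarith [hc k, norm_nonneg (c k)]
        gcongr
    _ = _ := by simp
end Resolvent

/-! ### The Green function: bounds and continuity in the phases. -/

theorem inner_basisVec (μ : Site) (ψ : L2Lattice) : inner ℂ (basisVec μ) ψ = ψ μ := by
  rw [basisVec, lp.inner_single_left]
  simp

theorem norm_basisVec (μ : Site) : ‖basisVec μ‖ = 1 := by
  rw [basisVec, lp.norm_single (by norm_num)]
  simp

theorem basisVec_apply_of_ne {μ ν : Site} (h : μ ≠ ν) : basisVec ν μ = 0 := by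
  rw [basisVec, lp.single_apply_ne _ _ _ h]

theorem basisVec_apply_self (μ : Site) : basisVec μ μ = 1 := by
  rw [basisVec, lp.single_apply_self]

theorem networkOp_apply (φ : ℝ) (ω : Site → Circle) (ψ : L2Lattice) (x : Site) :
    networkOp φ ω ψ x = ω x * ((Real.cos φ : ℂ) * ψ (anticlockwise.symm x)
      + (Complex.I * (Real.sin φ : ℂ)) * ψ (clockwise.symm x)) := rfl

theorem norm_networkOp_apply (φ : ℝ) (ω : Site → Circle) (ψ : L2Lattice) :
    ‖networkOp φ ω ψ‖ = ‖ψ‖ :=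
  ContinuousLinearMap.norm_map_of_mem_unitary (networkOp_mem_unitary φ ω) ψ

theorem networkOp_sub_resolvent (φ : ℝ) (ω : Site → Circle) {z : ℂ} (hz : ‖z‖ ≠ 1)
    (ψ : L2Lattice) :
    networkOp φ ω (networkResolvent φ ω z ψ) - z • networkResolvent φ ω z ψ = ψ := by
  have := congrArg (fun A : L2Lattice →L[ℂ] L2Lattice => A ψ)
    (Ring.mul_inverse_cancel _ (isUnit_networkOp_sub φ ω hz))
  simpa [networkResolvent] using this

theorem networkResolvent_sub (φ : ℝ) (ω : Site → Circle) {z : ℂ} (hz : ‖z‖ ≠ 1)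
    (ψ : L2Lattice) :
    networkResolvent φ ω z (networkOp φ ω ψ - z • ψ) = ψ := by
  have := congrArg (fun A : L2Lattice →L[ℂ] L2Lattice => A ψ)
    (Ring.inverse_mul_cancel _ (isUnit_networkOp_sub φ ω hz))
  simpa [networkResolvent] using this

/-- Since $U$ is isometric, $\|(U-z)\chi\|\ge|1-|z||\,\|\chi\|$. The bound blows up at the unit
circle and serves only for continuity and integrability. -/
theorem norm_networkResolvent_apply_le (φ : ℝ) (ω : Site → Circle) {z : ℂ} (hz : ‖z‖ ≠ 1)
    (ψ : L2Lattice) : ‖networkResolvent φ ω z ψ‖ ≤ |1 - ‖z‖|⁻¹ * ‖ψ‖ := by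
  have h := networkOp_sub_resolvent φ ω hz ψ
  set χ := networkResolvent φ ω z ψ
  have hpos : 0 < |1 - ‖z‖| := abs_pos.2 (sub_ne_zero.2 (Ne.symm hz))
  rw [inv_mul_eq_div, le_div_iff₀ hpos, ← h]
  have h1 := abs_norm_sub_norm_le (networkOp φ ω χ) (z • χ)
  rw [norm_networkOp_apply, norm_smul] at h1
  have e : ‖χ‖ - ‖z‖ * ‖χ‖ = (1 - ‖z‖) * ‖χ‖ := by ring
  rw [e, abs_mul, abs_norm] at h1
  linarith

/-- Continuity is strong only: a neighbourhood in the product topology controls finitely many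
phases, and the square summable $\xi$ dominates the rest. -/
theorem continuous_phaseOp_apply (ξ : L2Lattice) :
    Continuous fun ω : Site → Circle => phaseOp ω ξ := by
  rw [continuous_iff_continuousAt]
  intro ω₀
  rw [ContinuousAt, tendsto_iff_norm_sub_tendsto_zero]
  have hs : Summable fun μ => ‖ξ μ‖ ^ 2 := (memℓp_two_iff_summable _).1 (lp.memℓp ξ)
  have hc : Continuous fun ω : Site → Circle => ∑' μ, ‖((ω μ : ℂ) - ω₀ μ) * ξ μ‖ ^ 2 := by
    refine continuous_tsum (u := fun μ => 4 * ‖ξ μ‖ ^ 2) (fun μ => ?_) (hs.mul_left 4) ?_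
    · exact (((continuous_circle_coe.comp (continuous_apply μ)).sub
        continuous_const).mul continuous_const).norm.pow 2
    · intro μ ω
      rw [Real.norm_of_nonneg (by positivity), norm_mul, mul_pow]
      have h2 : ‖(ω μ : ℂ) - ω₀ μ‖ ≤ 2 := by
        refine (norm_sub_le _ _).trans ?_
        rw [Circle.norm_coe, Circle.norm_coe]; norm_num
      have : ‖(ω μ : ℂ) - ω₀ μ‖ ^ 2 ≤ 4 := by nlinarith [norm_nonneg ((ω μ : ℂ) - ω₀ μ)]
      gcongr
  have heq : ∀ ω, ‖phaseOp ω ξ - phaseOp ω₀ ξ‖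
      = Real.sqrt (∑' μ, ‖((ω μ : ℂ) - ω₀ μ) * ξ μ‖ ^ 2) := by
    intro ω
    rw [← Real.sqrt_sq (norm_nonneg (phaseOp ω ξ - phaseOp ω₀ ξ)), L2Lattice.norm_sq]
    congr 1
    refine tsum_congr fun μ => ?_
    rw [lp.coeFn_sub, Pi.sub_apply, phaseOp_apply, phaseOp_apply, sub_mul]
  simp only [heq]
  have := hc.sqrt.tendsto ω₀
  simpa using this

theorem continuous_networkResolvent_apply (φ : ℝ) {z : ℂ} (hz : ‖z‖ ≠ 1) (ψ : L2Lattice) :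
    Continuous fun ω : Site → Circle => networkResolvent φ ω z ψ := by
  rw [continuous_iff_continuousAt]
  intro ω₀
  rw [ContinuousAt, tendsto_iff_norm_sub_tendsto_zero]
  set χ := networkResolvent φ ω₀ z ψ with hχ
  have hU : Continuous fun ω => networkOp φ ω χ := continuous_phaseOp_apply (scatteringOp φ χ)
  have hlim : Filter.Tendsto (fun ω => |1 - ‖z‖|⁻¹ * ‖networkOp φ ω₀ χ - networkOp φ ω χ‖)
      (nhds ω₀) (nhds 0) := by
    have hc : Continuous fun ω => |1 - ‖z‖|⁻¹ * ‖networkOp φ ω₀ χ - networkOp φ ω χ‖ :=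
      continuous_const.mul (continuous_const.sub hU).norm
    have := hc.tendsto ω₀
    simpa using this
  refine squeeze_zero (fun _ => norm_nonneg _) (fun ω => ?_) hlim
  -- The second resolvent identity. With a resolvent bound uniform in $\omega$, strong continuity
  -- passes from $U$ to its resolvent.
  have e : networkResolvent φ ω z ψ - χ
      = networkResolvent φ ω z (networkOp φ ω₀ χ - networkOp φ ω χ) := by
    have h1 := networkOp_sub_resolvent φ ω₀ hz ψ
    rw [← hχ] at h1
    conv_lhs => rw [← networkResolvent_sub φ ω hz χ]
    rw [← map_sub]
    congr 1
    conv_lhs => rw [← h1]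
    abel
  rw [e]
  exact norm_networkResolvent_apply_le φ ω hz _

/-- The Green function `⟨e_x, (U_ω(φ) - z)⁻¹ e_y⟩`. -/
noncomputable def networkGreen (φ : ℝ) (z : ℂ) (x y : Site) (ω : Site → Circle) : ℂ :=
  networkResolvent φ ω z (basisVec y) x

theorem continuous_networkGreen (φ : ℝ) {z : ℂ} (hz : ‖z‖ ≠ 1) (x y : Site) :
    Continuous (networkGreen φ z x y) := by
  have : networkGreen φ z x y
      = fun ω => inner ℂ (basisVec x) (networkResolvent φ ω z (basisVec y)) := by
    ext ω; rw [inner_basisVec]; rfl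
  rw [this]
  exact continuous_const.inner (continuous_networkResolvent_apply φ hz _)

theorem norm_networkGreen_le (φ : ℝ) {z : ℂ} (hz : ‖z‖ ≠ 1) (x y : Site) (ω : Site → Circle) :
    ‖networkGreen φ z x y ω‖ ≤ |1 - ‖z‖|⁻¹ := by
  rw [networkGreen, ← inner_basisVec]
  refine (norm_inner_le_norm _ _).trans ?_
  rw [norm_basisVec, one_mul]
  simpa [norm_basisVec] using norm_networkResolvent_apply_le φ ω hz (basisVec y)

theorem continuous_norm_networkGreen_rpow (φ : ℝ) {z : ℂ} (hz : ‖z‖ ≠ 1) (x y : Site) {p : ℝ}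
    (hp : 0 < p) : Continuous fun ω => ‖networkGreen φ z x y ω‖ ^ p :=
  (continuous_networkGreen φ hz x y).norm.rpow_const fun _ => Or.inr hp.le

theorem abs_norm_networkGreen_rpow_le (φ : ℝ) {z : ℂ} (hz : ‖z‖ ≠ 1) (x y : Site) {p : ℝ}
    (hp : 0 < p) (ω : Site → Circle) :
    |‖networkGreen φ z x y ω‖ ^ p| ≤ (|1 - ‖z‖|⁻¹) ^ p := by
  rw [abs_of_nonneg (by positivity)]
  exact Real.rpow_le_rpow (norm_nonneg _) (norm_networkGreen_le φ hz x y ω) hp.le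

theorem integrable_norm_networkGreen_rpow (φ : ℝ) {z : ℂ} (hz : ‖z‖ ≠ 1) (x y : Site) {p : ℝ}
    (hp : 0 < p) : Integrable (fun ω => ‖networkGreen φ z x y ω‖ ^ p) phaseLaw :=
  (continuous_norm_networkGreen_rpow φ hz x y hp).integrable_phaseLaw
    (abs_norm_networkGreen_rpow_le φ hz x y hp)

/-! ### Moment bounds uniform in the spectral parameter. -/

theorem networkOp_const_mul (φ : ℝ) (t : Circle) (ω : Site → Circle) :
    networkOp φ ((fun _ => t) * ω) = (t : ℂ) • networkOp φ ω := by
  ext ψ x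
  change networkOp φ ((fun _ => t) * ω) ψ x = (t : ℂ) * networkOp φ ω ψ x
  rw [networkOp_apply, networkOp_apply, Pi.mul_apply, Circle.coe_mul, mul_assoc]

theorem norm_networkOp_le (φ : ℝ) (ω : Site → Circle) : ‖networkOp φ ω‖ ≤ 1 :=
  ContinuousLinearMap.opNorm_le_bound _ zero_le_one fun ψ => by
    rw [norm_networkOp_apply, one_mul]

/-- The a priori bound on fractional moments of the Green function. -/
theorem integral_norm_networkGreen_rpow_le {p : ℝ} (hp0 : 0 < p) (hp1 : p < 1) (φ : ℝ) {z : ℂ}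
    (hz : ‖z‖ ≠ 1) (x y : Site) :
    ∫ ω, ‖networkGreen φ z x y ω‖ ^ p ∂phaseLaw
      ≤ 4 * (4 ^ p / Real.cos (Real.pi * p / 2)) := by
  have hfc := continuous_norm_networkGreen_rpow φ hz x y hp0
  have hfB := abs_norm_networkGreen_rpow_le φ hz x y hp0
  -- It suffices to average over a common rotation of all phases, with $\omega$ fixed.
  suffices h : ∃ τ : Circle → Site → Circle, Continuous τ ∧ ∀ ω,
      ∫ t, ‖networkGreen φ z x y (τ t * ω)‖ ^ p ∂circleLaw
        ≤ 4 * (4 ^ p / Real.cos (Real.pi * p / 2)) by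
    obtain ⟨τ, hτ, hb⟩ := h
    obtain ⟨hi, he⟩ := integral_phaseLaw_eq_average hfc hfB hτ
    rw [he]
    refine (integral_mono hi (integrable_const _) hb).trans ?_
    simp
  rcases lt_or_gt_of_ne hz with hlt | hgt
  · refine ⟨fun t _ => t⁻¹, continuous_pi fun _ => continuous_inv, fun ω => ?_⟩
    set U := networkOp φ ω
    have hU := networkOp_mem_unitary φ ω
    have hV : ‖star U‖ ≤ 1 := ContinuousLinearMap.opNorm_le_bound _ zero_le_one fun ψ => by
      rw [one_mul]
      exact (ContinuousLinearMap.norm_map_of_mem_unitary (Unitary.star_mem hU) ψ).le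
    refine le_trans (le_of_eq (integral_congr_ae (ae_of_all _ fun t => ?_)))
      (fractional_moment_inner hV hlt (a := U (basisVec x)) (b := basisVec y)
        (by rw [norm_networkOp_apply, norm_basisVec]) (norm_basisVec y).le hp0 hp1)
    simp only
    congr 1
    have ht : (t : ℂ) ≠ 0 := Circle.coe_ne_zero t
    have hu : IsUnit (1 - ((t : ℂ) * z) • star U) := by
      apply isUnit_one_sub_of_norm_lt_one
      rw [norm_smul, norm_mul, Circle.norm_coe, one_mul]
      nlinarith [norm_nonneg z, norm_nonneg (star U)]
    set A := Ring.inverse (1 - ((t : ℂ) * z) • star U)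
    have hA : A (basisVec y) - ((t : ℂ) * z) • star U (A (basisVec y)) = basisVec y := by
      have := congrArg (fun A : L2Lattice →L[ℂ] L2Lattice => A (basisVec y))
        (Ring.mul_inverse_cancel _ hu)
      simpa using this
    have hUs : ∀ ψ, U (star U ψ) = ψ := fun ψ =>
      congrArg (fun A : L2Lattice →L[ℂ] L2Lattice => A ψ) (Unitary.mul_star_self_of_mem hU)
    have key : networkResolvent φ ((fun _ => t⁻¹) * ω) z (basisVec y)
        = (t : ℂ) • star U (A (basisVec y)) := by
      rw [← networkResolvent_sub φ ((fun _ => t⁻¹) * ω) hz ((t : ℂ) • star U (A (basisVec y)))]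
      congr 1
      rw [networkOp_const_mul, smul_apply, map_smul, hUs, smul_smul,
        Circle.coe_inv, inv_mul_cancel₀ ht, one_smul, smul_smul, mul_comm z, hA]
    have hadj : inner ℂ (basisVec x) (star U (A (basisVec y)))
        = inner ℂ (U (basisVec x)) (A (basisVec y)) :=
      ContinuousLinearMap.adjoint_inner_right U _ _
    rw [networkGreen, ← inner_basisVec, key, inner_smul_right, norm_mul, Circle.norm_coe, one_mul,
      hadj]
  -- Outside the disc, $(tU-z)^{-1}=-z^{-1}(1-tz^{-1}U)^{-1}$, so $w=z^{-1}$.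
  · refine ⟨fun t _ => t, continuous_pi fun _ => continuous_id, fun ω => ?_⟩
    set U := networkOp φ ω
    have hz0 : z ≠ 0 := norm_pos_iff.1 (zero_lt_one.trans hgt)
    have hw : ‖z⁻¹‖ < 1 := by rw [norm_inv]; exact inv_lt_one_of_one_lt₀ hgt
    refine le_trans (integral_mono_of_nonneg (ae_of_all _ fun t => by positivity) ?_
      (ae_of_all _ fun t => ?_))
      (fractional_moment_inner (norm_networkOp_le φ ω) hw (norm_basisVec x).le
        (norm_basisVec y).le hp0 hp1)
    · exact ((continuous_const.inner ((continuous_inverse_one_sub_smul (norm_networkOp_le φ ω)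
        hw).clm_apply continuous_const)).norm.rpow_const fun _ => Or.inr hp0.le).integrable_circleLaw
    · simp only
      refine Real.rpow_le_rpow (norm_nonneg _) ?_ hp0.le
      have hu : IsUnit (1 - ((t : ℂ) * z⁻¹) • U) := by
        apply isUnit_one_sub_of_norm_lt_one
        rw [norm_smul, norm_mul, Circle.norm_coe, one_mul]
        nlinarith [norm_nonneg z⁻¹, norm_nonneg U, norm_networkOp_le φ ω]
      set A := Ring.inverse (1 - ((t : ℂ) * z⁻¹) • U)
      have hA : A (basisVec y) - ((t : ℂ) * z⁻¹) • U (A (basisVec y)) = basisVec y := by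
        have := congrArg (fun A : L2Lattice →L[ℂ] L2Lattice => A (basisVec y))
          (Ring.mul_inverse_cancel _ hu)
        simpa using this
      have key : networkResolvent φ ((fun _ => t) * ω) z (basisVec y)
          = (-z⁻¹) • A (basisVec y) := by
        rw [← networkResolvent_sub φ ((fun _ => t) * ω) hz ((-z⁻¹) • A (basisVec y))]
        congr 1
        rw [networkOp_const_mul, smul_apply, map_smul, smul_smul, smul_smul,
          mul_neg, mul_neg, mul_inv_cancel₀ hz0]
        conv_lhs => rw [← hA]
        module
      rw [networkGreen, ← inner_basisVec, key, inner_smul_right, norm_mul, norm_neg]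
      exact mul_le_of_le_one_left (norm_nonneg _) hw.le

/-! ### Dependence on a single phase. -/

theorem networkOp_mulSingle_mul (φ : ℝ) (b : Site) (t : Circle) (ω : Site → Circle)
    (ψ : L2Lattice) :
    networkOp φ (Pi.mulSingle b t * ω) ψ
      = networkOp φ ω ψ + (((t : ℂ) - 1) * networkOp φ ω ψ b) • basisVec b := by
  ext x
  have h1 : networkOp φ (Pi.mulSingle b t * ω) ψ x
      = (Pi.mulSingle b t : Site → Circle) x * networkOp φ ω ψ x := by
    rw [networkOp_apply, networkOp_apply, Pi.mul_apply, Circle.coe_mul, mul_assoc]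
  refine h1.trans ?_
  rw [lp.coeFn_add, Pi.add_apply, lp.coeFn_smul, Pi.smul_apply, smul_eq_mul]
  by_cases h : x = b
  · subst h
    rw [Pi.mulSingle_eq_same, basisVec_apply_self]
    ring
  · rw [Pi.mulSingle_eq_of_ne h, basisVec_apply_of_ne h]
    simp

/-- The resolvent identity for the rank one perturbation caused by changing one phase. -/
theorem networkResolvent_mulSingle_mul (φ : ℝ) (b : Site) (t : Circle) (ω : Site → Circle) {z : ℂ}
    (hz : ‖z‖ ≠ 1) (η : L2Lattice) :
    networkResolvent φ (Pi.mulSingle b t * ω) z η = networkResolvent φ ω z η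
      - (((t : ℂ) - 1) * networkOp φ ω (networkResolvent φ ω z η) b) •
        networkResolvent φ (Pi.mulSingle b t * ω) z (basisVec b) := by
  set ψ := networkResolvent φ ω z η with hψ
  have h1 := networkOp_sub_resolvent φ ω hz η
  rw [← hψ] at h1
  have h2 := networkResolvent_sub φ (Pi.mulSingle b t * ω) hz ψ
  rw [networkOp_mulSingle_mul, add_sub_right_comm, h1, map_add, map_smul] at h2
  rw [eq_sub_iff_add_eq, h2]

/-- The Green function is a fractional linear function of each of the phases. -/
theorem exists_networkGreen_fractional_linear (φ : ℝ) (b y : Site) (ω : Site → Circle) {z : ℂ}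
    (hz : ‖z‖ ≠ 1) : ∃ (γ δ : ℂ) (α β : Site → ℂ), 0 < ‖γ‖ + ‖δ‖ ∧ ∀ x (t : Circle),
      (γ + t * δ) * networkGreen φ z x y (Pi.mulSingle b t * ω) = α x + t * β x := by
  set χ := networkResolvent φ ω z (basisVec b) with hχ
  set ψ := networkResolvent φ ω z (basisVec y) with hψ
  set d := networkOp φ ω χ b with hd
  set e := networkOp φ ω ψ b with he
  -- For $\eta=e_b$ the perturbation identity gives $(1-d+td)F=\chi_x$; substitution in the identity
  -- for $\eta=e_y$ gives the quotient. The denominator does not depend on $x$, and $|1-d|+|d|\ge1$.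
  refine ⟨1 - d, d, fun x => (1 - d) * ψ x + e * χ x, fun x => d * ψ x - e * χ x, ?_, ?_⟩
  · have := norm_add_le (1 - d) d
    rw [sub_add_cancel, norm_one] at this
    linarith
  · intro x t
    have h1 := networkResolvent_mulSingle_mul φ b t ω hz (basisVec b)
    have h2 := networkResolvent_mulSingle_mul φ b t ω hz (basisVec y)
    rw [← hχ, ← hd] at h1
    rw [← hψ, ← he] at h2
    have g1 : networkGreen φ z x b (Pi.mulSingle b t * ω)
        = χ x - (((t : ℂ) - 1) * d) * networkGreen φ z x b (Pi.mulSingle b t * ω) :=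
      congrArg (fun ξ : L2Lattice => ξ x) h1
    have g2 : networkGreen φ z x y (Pi.mulSingle b t * ω)
        = ψ x - (((t : ℂ) - 1) * e) * networkGreen φ z x b (Pi.mulSingle b t * ω) :=
      congrArg (fun ξ : L2Lattice => ξ x) h2
    set G := networkGreen φ z x y (Pi.mulSingle b t * ω)
    set F := networkGreen φ z x b (Pi.mulSingle b t * ω)
    linear_combination (1 - d + t * d) * g2 - (t - 1) * e * g1

/-! ### The block equation and the recursive inequality. -/

theorem networkGreen_eq (φ : ℝ) (ω : Site → Circle) {z : ℂ} (hz : ‖z‖ ≠ 1) {x y : Site}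
    (h : x ≠ y) :
    z * networkGreen φ z x y ω = ω x * ((Real.cos φ : ℂ) *
      networkGreen φ z (anticlockwise.symm x) y ω
        + (Complex.I * (Real.sin φ : ℂ)) * networkGreen φ z (clockwise.symm x) y ω) := by
  have h1 := congrArg (fun ξ : L2Lattice => ξ x) (networkOp_sub_resolvent φ ω hz (basisVec y))
  simp only [lp.coeFn_sub, Pi.sub_apply, basisVec_apply_of_ne h, networkOp_apply, lp.coeFn_smul,
    Pi.smul_apply, smul_eq_mul] at h1
  exact (sub_eq_zero.1 h1).symm

theorem exists_block_position (x : Site) : ∃ j k : ℤ, x = (2 * j, 2 * k) ∨ x = (2 * j + 1, 2 * k) ∨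
    x = (2 * j + 1, 2 * k + 1) ∨ x = (2 * j, 2 * k + 1) := by
  refine ⟨x.1 / 2, x.2 / 2, ?_⟩
  simp only [Prod.ext_iff]
  omega

theorem anticlockwise_four (x : Site) :
    anticlockwise (anticlockwise (anticlockwise (anticlockwise x))) = x := by
  obtain ⟨j, k, h⟩ := exists_block_position x
  obtain ⟨h1, h2, h3, h4⟩ := anticlockwise_block j k
  rcases h with rfl | rfl | rfl | rfl <;> simp only [h1, h2, h3, h4]

theorem anticlockwise_iterate_ne (x : Site) : anticlockwise x ≠ x ∧
    anticlockwise (anticlockwise x) ≠ x ∧ anticlockwise (anticlockwise (anticlockwise x)) ≠ x := by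
  obtain ⟨j, k, h⟩ := exists_block_position x
  obtain ⟨h1, h2, h3, h4⟩ := anticlockwise_block j k
  rcases h with rfl | rfl | rfl | rfl <;> simp only [h1, h2, h3, h4, Ne, Prod.ext_iff] <;> omega

theorem anticlockwise_pow_near (x : Site) (i : Fin 4) :
    |((anticlockwise ^ (i : ℕ)) x).1 - x.1| ≤ 1 ∧ |((anticlockwise ^ (i : ℕ)) x).2 - x.2| ≤ 1 := by
  obtain ⟨j, k, h⟩ := exists_block_position x
  obtain ⟨h1, h2, h3, h4⟩ := anticlockwise_block j k
  rcases h with rfl | rfl | rfl | rfl <;> fin_cases i <;>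
    simp only [pow_succ, pow_zero, one_mul, Equiv.Perm.mul_apply, Equiv.Perm.one_apply, h1, h2, h3,
      h4, abs_le] <;> omega

theorem clockwise_symm_near (x : Site) :
    |(clockwise.symm x).1 - x.1| ≤ 1 ∧ |(clockwise.symm x).2 - x.2| ≤ 1 := by
  simp only [clockwise, Equiv.coe_fn_symm_mk, abs_le]
  split_ifs <;> dsimp only <;> omega

/-- The sites outside the anticlockwise block of `x` from which `S_↻` leads into the block. -/
def blockNeighbor (x : Site) (k : Fin 4) : Site := clockwise.symm ((anticlockwise ^ (k : ℕ)) x)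

/-- The equations at the four sites of the block are chained backwards along the cycle,
$x,x_3,x_2,x_1$, until $G(x,y)$ returns with the factor $\cos^4\varphi$ times all four phases. Each
step leaves a source term with the factor $\sin\varphi$. The condition on $y$ keeps the equations
homogeneous. -/
theorem networkGreen_block (φ : ℝ) (ω : Site → Circle) {z : ℂ} (hz : ‖z‖ ≠ 1) {x y : Site}
    (h : ∀ k : Fin 4, (anticlockwise ^ (k : ℕ)) x ≠ y) :
    ‖z ^ 4 + (ω x : ℂ) * -((Real.cos φ : ℂ) ^ 4 * (ω (anticlockwise x) *
        ω (anticlockwise (anticlockwise x)) *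
        ω (anticlockwise (anticlockwise (anticlockwise x)))))‖ * ‖networkGreen φ z x y ω‖
      ≤ |Real.sin φ| * (max 1 ‖z‖) ^ 3 * ∑ k, ‖networkGreen φ z (blockNeighbor x k) y ω‖ := by
  have h0 := networkGreen_eq φ ω hz (h 0)
  have h1 := networkGreen_eq φ ω hz (h 1)
  have h2 := networkGreen_eq φ ω hz (h 2)
  have h3 := networkGreen_eq φ ω hz (h 3)
  have e0 : (anticlockwise ^ ((0 : Fin 4) : ℕ)) x = x := rfl
  have e1 : (anticlockwise ^ ((1 : Fin 4) : ℕ)) x = anticlockwise x := rfl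
  have e2 : (anticlockwise ^ ((2 : Fin 4) : ℕ)) x = anticlockwise (anticlockwise x) := rfl
  have e3 : (anticlockwise ^ ((3 : Fin 4) : ℕ)) x
    = anticlockwise (anticlockwise (anticlockwise x)) := rfl
  have es : anticlockwise.symm x = anticlockwise (anticlockwise (anticlockwise x)) := by
    rw [Equiv.symm_apply_eq, anticlockwise_four]
  rw [Fin.sum_univ_four]
  simp only [blockNeighbor, e0, e1, e2, e3, Equiv.symm_apply_apply, es] at h0 h1 h2 h3 ⊢
  set x₁ := anticlockwise x
  set x₂ := anticlockwise x₁
  set x₃ := anticlockwise x₂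
  set η₀ := networkGreen φ z (clockwise.symm x) y ω
  set η₁ := networkGreen φ z (clockwise.symm x₁) y ω
  set η₂ := networkGreen φ z (clockwise.symm x₂) y ω
  set η₃ := networkGreen φ z (clockwise.symm x₃) y ω
  set ψ₀ := networkGreen φ z x y ω
  set ψ₁ := networkGreen φ z x₁ y ω
  set ψ₂ := networkGreen φ z x₂ y ω
  set ψ₃ := networkGreen φ z x₃ y ω
  set c : ℂ := (Real.cos φ : ℂ)
  have hc : ‖c‖ ≤ 1 := by
    rw [Complex.norm_real]; exact Real.abs_cos_le_one φ
  set σ : ℂ := (Real.sin φ : ℂ)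
  have hσ : ‖σ‖ = |Real.sin φ| := Complex.norm_real _
  have hmain : (z ^ 4 + ω x * -(c ^ 4 * (ω x₁ * ω x₂ * ω x₃))) * ψ₀
      = Complex.I * σ * (z ^ 3 * ω x * η₀ + z ^ 2 * c * (ω x * ω x₃) * η₃
        + z * c ^ 2 * (ω x * ω x₃ * ω x₂) * η₂
        + c ^ 3 * (ω x * ω x₃ * ω x₂ * ω x₁) * η₁) := by
    linear_combination z ^ 3 * h0 + z ^ 2 * c * ω x * h3 + z * c ^ 2 * ω x * ω x₃ * h2
      + c ^ 3 * ω x * ω x₃ * ω x₂ * h1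
  rw [← norm_mul, hmain, norm_mul, norm_mul, Complex.norm_I, one_mul, hσ, mul_assoc |Real.sin φ|]
  refine mul_le_mul_of_nonneg_left ?_ (abs_nonneg (Real.sin φ))
  set m := max 1 ‖z‖
  have hm1 : 1 ≤ m := le_max_left _ _
  have hzm : ‖z‖ ≤ m := le_max_right _ _
  have hz0 := norm_nonneg z
  have hc0 := norm_nonneg c
  have b3 : ‖z‖ ^ 3 ≤ m ^ 3 := pow_le_pow_left₀ hz0 hzm 3
  have b2 : ‖z‖ ^ 2 * ‖c‖ ≤ m ^ 3 :=
    calc ‖z‖ ^ 2 * ‖c‖ ≤ m ^ 2 * 1 := by gcongr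
      _ ≤ m ^ 3 := by rw [mul_one]; exact pow_le_pow_right₀ hm1 (by norm_num)
  have b1 : ‖z‖ * ‖c‖ ^ 2 ≤ m ^ 3 :=
    calc ‖z‖ * ‖c‖ ^ 2 ≤ m * 1 := by gcongr; exact pow_le_one₀ hc0 hc
      _ ≤ m ^ 3 := by rw [mul_one]; exact le_self_pow₀ hm1 (by norm_num)
  have b0 : ‖c‖ ^ 3 ≤ m ^ 3 := (pow_le_one₀ (n := 3) hc0 hc).trans (one_le_pow₀ hm1)
  refine norm_add₄_le.trans ?_
  simp only [norm_mul, norm_pow, Circle.norm_coe, mul_one]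
  have n0 := mul_le_mul_of_nonneg_right b3 (norm_nonneg η₀)
  have n1 := mul_le_mul_of_nonneg_right b2 (norm_nonneg η₃)
  have n2 := mul_le_mul_of_nonneg_right b1 (norm_nonneg η₂)
  have n3 := mul_le_mul_of_nonneg_right b0 (norm_nonneg η₁)
  linarith

/-- The average over a single phase of the linear inequality between fractional moments. -/
theorem circle_integral_networkGreen_le_sum {p K : ℝ} (hp0 : 0 < p) (hK : 0 < K)
    (hdec : ∀ (r : Circle → ℂ) (q : Fin 4 → Circle → ℂ) (γ₀ δ₀ γ₁ δ₁ : ℂ)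
      (α β : Fin 4 → ℂ) (ε : ℝ), Continuous r → (∀ k, Continuous (q k)) → 0 ≤ ε →
      0 < ‖γ₀‖ + ‖δ₀‖ → 0 < ‖γ₁‖ + ‖δ₁‖ →
      (∀ k t, (γ₁ + t * δ₁) * q k t = α k + t * β k) →
      (∀ t : Circle, ‖γ₀ + t * δ₀‖ * ‖r t‖ ≤ ε * ∑ k, ‖q k t‖) →
      ∫ t, ‖r t‖ ^ p ∂circleLaw
        ≤ K * (ε / (‖γ₀‖ + ‖δ₀‖)) ^ p * ∑ k, ∫ t, ‖q k t‖ ^ p ∂circleLaw)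
    {φ : ℝ} (hφ : |φ| ≤ 1) {z : ℂ} (hz : ‖z‖ ≠ 1) {x y : Site}
    (hxy : ∀ k : Fin 4, (anticlockwise ^ (k : ℕ)) x ≠ y) (ω : Site → Circle)
    {τ : Circle → Site → Circle} (hτ : Continuous τ) (hτx : ∀ t, τ t x = t)
    (hτo : ∀ t x', x' ≠ x → τ t x' = 1)
    (hfl : ∃ (γ δ : ℂ) (α β : Site → ℂ), 0 < ‖γ‖ + ‖δ‖ ∧ ∀ x (t : Circle),
      (γ + t * δ) * networkGreen φ z x y (τ t * ω) = α x + t * β x) :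
    ∫ t, ‖networkGreen φ z x y (τ t * ω)‖ ^ p ∂circleLaw ≤ K * (16 * |φ|) ^ p *
        ∑ k, ∫ t, ‖networkGreen φ z (blockNeighbor x k) y (τ t * ω)‖ ^ p ∂circleLaw := by
  obtain ⟨γ, δ, α, β, hN, hfl⟩ := hfl
  obtain ⟨ne1, ne2, ne3⟩ := anticlockwise_iterate_ne x
  set Ω : ℂ := ω x * (ω (anticlockwise x) *
        ω (anticlockwise (anticlockwise x)) *
        ω (anticlockwise (anticlockwise (anticlockwise x)))) with hΩ
  have hΩn : ‖Ω‖ = 1 := by simp [hΩ, Circle.norm_coe]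
  have hcos : (1 : ℝ) / 2 ≤ Real.cos φ := by
    have := Real.one_sub_sq_div_two_le_cos (x := φ)
    have h2 : φ ^ 2 ≤ 1 := by rw [← sq_abs]; exact pow_le_one₀ (abs_nonneg _) hφ
    linarith
  -- The $16$ comes from $\cos\varphi\ge1/2$. For $|z|\le1$ the cosine term gives the bound, for
  -- $|z|\ge1$ the term $|z|^4$; hence the final constant does not depend on $z$.
  have hN0 : (max 1 ‖z‖) ^ 3 / 16 ≤ ‖z ^ 4‖ + ‖-((Real.cos φ : ℂ) ^ 4 * Ω)‖ := by
    rw [norm_neg, norm_mul, hΩn, norm_pow, norm_pow, Complex.norm_real, mul_one,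
      Real.norm_of_nonneg (by linarith)]
    have h4 : ((1 : ℝ) / 2) ^ 4 ≤ Real.cos φ ^ 4 := pow_le_pow_left₀ (by norm_num) hcos 4
    rcases le_total ‖z‖ 1 with h | h
    · rw [max_eq_left h]
      have : 0 ≤ ‖z‖ ^ 4 := by positivity
      norm_num at h4 ⊢
      linarith
    · rw [max_eq_right h]
      have h34 : ‖z‖ ^ 3 ≤ ‖z‖ ^ 4 := pow_le_pow_right₀ h (by norm_num)
      have : 0 ≤ ‖z‖ ^ 3 := by positivity
      have : (0 : ℝ) ≤ (1 / 2) ^ 4 := by norm_num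
      linarith
  have hm : 0 < (max 1 ‖z‖) ^ 3 := by positivity
  have hpos : 0 < ‖z ^ 4‖ + ‖-((Real.cos φ : ℂ) ^ 4 * Ω)‖ := by linarith
  have hd := hdec (fun t => networkGreen φ z x y (τ t * ω))
    (fun k t => networkGreen φ z (blockNeighbor x k) y (τ t * ω))
    (z ^ 4) (-((Real.cos φ : ℂ) ^ 4 * Ω)) γ δ (fun k => α (blockNeighbor x k))
    (fun k => β (blockNeighbor x k)) (|Real.sin φ| * (max 1 ‖z‖) ^ 3)
    ((continuous_networkGreen φ hz x y).comp (hτ.mul continuous_const))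
    (fun k => (continuous_networkGreen φ hz _ y).comp (hτ.mul continuous_const))
    (by positivity) hpos hN (fun k t => hfl _ t) ?_
  · refine hd.trans ?_
    have hs : |Real.sin φ| * (max 1 ‖z‖) ^ 3 / (‖z ^ 4‖ + ‖-((Real.cos φ : ℂ) ^ 4 * Ω)‖)
        ≤ 16 * |φ| := by
      rw [div_le_iff₀ hpos]
      have h1 : |Real.sin φ| * (max 1 ‖z‖) ^ 3 ≤ |φ| * (max 1 ‖z‖) ^ 3 :=
        mul_le_mul_of_nonneg_right Real.abs_sin_le_abs hm.le
      have h2 := mul_le_mul_of_nonneg_left hN0 (abs_nonneg φ)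
      linarith
    have hQ : 0 ≤ ∑ k, ∫ t, ‖networkGreen φ z (blockNeighbor x k) y (τ t * ω)‖ ^ p
        ∂circleLaw := Finset.sum_nonneg fun k _ => integral_nonneg fun t => by positivity
    gcongr
  · intro t
    have hb := networkGreen_block φ (τ t * ω) hz hxy
    have ex : ((τ t * ω) x : ℂ) = t * ω x := by
      rw [Pi.mul_apply, hτx, Circle.coe_mul]
    have eo : ∀ x', x' ≠ x → (τ t * ω) x' = ω x' := fun x' h => by
      rw [Pi.mul_apply, hτo t x' h, one_mul]
    rw [ex, eo _ ne1, eo _ ne2, eo _ ne3] at hb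
    have e : (t : ℂ) * -((Real.cos φ : ℂ) ^ 4 * Ω) = t * ω x * -((Real.cos φ : ℂ) ^ 4 *
        (ω (anticlockwise x) * ω (anticlockwise (anticlockwise x)) *
        ω (anticlockwise (anticlockwise (anticlockwise x))))) := by
      rw [hΩ]; ring
    rw [e]
    exact hb

/-- Away from the block of `y` the fractional moments of the Green function satisfy a linear
inequality with a small constant. -/
theorem exists_integral_networkGreen_le_sum {p : ℝ} (hp0 : 0 < p) (hp1 : 2 * p < 1) :
    ∃ K : ℝ, 0 < K ∧ ∀ φ : ℝ, |φ| ≤ 1 → ∀ (z : ℂ), ‖z‖ ≠ 1 → ∀ x y : Site,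
      (∀ k : Fin 4, (anticlockwise ^ (k : ℕ)) x ≠ y) →
      ∫ ω, ‖networkGreen φ z x y ω‖ ^ p ∂phaseLaw ≤ K * (16 * |φ|) ^ p *
        ∑ k, ∫ ω, ‖networkGreen φ z (blockNeighbor x k) y ω‖ ^ p ∂phaseLaw := by
  obtain ⟨K, hK, hdec⟩ := fractional_moment_decoupling hp0 hp1
  refine ⟨K, hK, fun φ hφ z hz x y hxy => ?_⟩
  have hτ : Continuous fun t : Circle => (Pi.mulSingle x t : Site → Circle) := by
    exact continuous_mulSingle (A := fun _ : Site => Circle) x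
  have hav := fun x' => integral_phaseLaw_eq_average
    (continuous_norm_networkGreen_rpow φ hz x' y hp0)
    (abs_norm_networkGreen_rpow_le φ hz x' y hp0) hτ
  rw [(hav x).2]
  simp only [fun k => (hav (blockNeighbor x k)).2]
  rw [← integral_finsetSum _ fun k _ => (hav (blockNeighbor x k)).1, ← integral_const_mul]
  refine integral_mono (hav x).1
    ((integrable_finsetSum _ fun k _ => (hav (blockNeighbor x k)).1).const_mul _) fun ω => ?_
  have h := circle_integral_networkGreen_le_sum hp0 hK hdec hφ hz hxy ω hτ
    (fun t => by rw [Pi.mulSingle_eq_same]) (fun t x' h => by rw [Pi.mulSingle_eq_of_ne h])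
    (exists_networkGreen_fractional_linear φ x y ω hz)
  exact h

/-! ### Iteration, interpolation and conclusion. -/

/-- Each use of the inequality gains $4\kappa\le e^{-1}$ and moves each coordinate by at most $2$:
one inside the block, one along `clockwise.symm`. So $n$ uses are possible at sup distance $2n$ from
$y$. -/
theorem le_mul_exp_of_le_sum {f : Site → ℝ} {y : Site} {C κ : ℝ} (hf : ∀ x, f x ≤ C) (hC : 0 ≤ C)
    (hκ0 : 0 ≤ κ) (hκ : 4 * κ ≤ Real.exp (-1))
    (h : ∀ x, (∀ k : Fin 4, (anticlockwise ^ (k : ℕ)) x ≠ y) →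
      f x ≤ κ * ∑ k, f (blockNeighbor x k)) (n : ℕ) :
    ∀ x : Site, 2 * (n : ℤ) ≤ max |x.1 - y.1| |x.2 - y.2| → f x ≤ C * Real.exp (-n) := by
  induction n with
  | zero => intro x _; simpa using hf x
  | succ n ih =>
    intro x hx
    have hxy : ∀ k : Fin 4, (anticlockwise ^ (k : ℕ)) x ≠ y := by
      rintro k rfl
      obtain ⟨h1, h2⟩ := anticlockwise_pow_near x k
      rw [abs_sub_comm] at h1 h2
      have := max_le h1 h2
      rw [Nat.cast_succ] at hx
      linarith [Int.natCast_nonneg n]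
    have hnb : ∀ k, f (blockNeighbor x k) ≤ C * Real.exp (-n) := by
      intro k
      apply ih
      obtain ⟨h1, h2⟩ := anticlockwise_pow_near x k
      obtain ⟨h3, h4⟩ := clockwise_symm_near ((anticlockwise ^ (k : ℕ)) x)
      rw [blockNeighbor]
      set u := (anticlockwise ^ (k : ℕ)) x
      set v := clockwise.symm u
      rw [le_max_iff] at hx ⊢
      push_cast at hx
      rcases hx with hx | hx
      · left
        have t1 := abs_sub_le x.1 u.1 y.1
        have t2 := abs_sub_le u.1 v.1 y.1
        have c1 := abs_sub_comm x.1 u.1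
        have c2 := abs_sub_comm u.1 v.1
        linarith
      · right
        have t1 := abs_sub_le x.2 u.2 y.2
        have t2 := abs_sub_le u.2 v.2 y.2
        have c1 := abs_sub_comm x.2 u.2
        have c2 := abs_sub_comm u.2 v.2
        linarith
    calc f x ≤ κ * ∑ k, f (blockNeighbor x k) := h x hxy
      _ ≤ κ * ∑ _k : Fin 4, C * Real.exp (-n) :=
          mul_le_mul_of_nonneg_left (Finset.sum_le_sum fun k _ => hnb k) hκ0
      _ = 4 * κ * (C * Real.exp (-n)) := by simp; ring
      _ ≤ Real.exp (-1) * (C * Real.exp (-n)) :=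
          mul_le_mul_of_nonneg_right hκ (by positivity)
      _ = C * Real.exp (-(n + 1 : ℕ)) := by
          rw [mul_left_comm, ← Real.exp_add]; congr 2; push_cast; ring

theorem siteNorm_le_two_mul_max (u : Site) : siteNorm u ≤ 2 * ((max |u.1| |u.2| : ℤ) : ℝ) := by
  push_cast
  set a := |(u.1 : ℝ)| with ha
  set b := |(u.2 : ℝ)| with hb
  rw [siteNorm, ← sq_abs (u.1 : ℝ), ← sq_abs (u.2 : ℝ), ← ha, ← hb]
  have ha0 : 0 ≤ a := abs_nonneg _
  have hb0 : 0 ≤ b := abs_nonneg _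
  refine Real.sqrt_le_iff.2 ⟨by positivity, ?_⟩
  have h1 := le_max_left a b
  have h2 := le_max_right a b
  nlinarith

/-- Weighted arithmetic-geometric mean inequality with weights $1-s$ and $s$: the exponents average
to $s$ and the exponentials cancel. It transfers decay from order $s/2<1/2$, where decoupling works,
to order $s$. -/
theorem rpow_le_geometric_split {s x : ℝ} (hs0 : 0 < s) (hs1 : s < 1) (hx : 0 ≤ x) (n : ℝ) :
    x ^ s ≤ Real.exp (s * n) * x ^ (s / 2) + Real.exp (-(1 - s) * n) * x ^ ((1 + s) / 2) := by
  have hX : 0 ≤ Real.exp (s * n) * x ^ (s / 2) := by positivity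
  have hY : 0 ≤ Real.exp (-(1 - s) * n) * x ^ ((1 + s) / 2) := by positivity
  have h := Real.geom_mean_le_arith_mean2_weighted (sub_nonneg.2 hs1.le) hs0.le hX hY (by ring)
  have e : (Real.exp (s * n) * x ^ (s / 2)) ^ (1 - s) *
      (Real.exp (-(1 - s) * n) * x ^ ((1 + s) / 2)) ^ s = x ^ s := by
    rw [Real.mul_rpow (by positivity) (by positivity), Real.mul_rpow (by positivity) (by positivity),
      ← Real.exp_mul, ← Real.exp_mul, ← Real.rpow_mul hx, ← Real.rpow_mul hx,
      mul_mul_mul_comm, ← Real.exp_add, ← Real.rpow_add_of_nonneg hx (by nlinarith) (by positivity)]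
    rw [show s * n * (1 - s) + -(1 - s) * n * s = 0 by ring, Real.exp_zero, one_mul]
    congr 1; ring
  rw [e] at h
  nlinarith

theorem theorem3 (s : ℝ) (hs0 : 0 < s) (hs1 : s < 1) :
    ∃ φ₀ c g : ℝ, 0 < φ₀ ∧ 0 < c ∧ 0 < g ∧
      ∀ φ : ℝ, |φ| ≤ φ₀ → ∀ (μ ν : Site) (z : ℂ), ‖z‖ ≠ 1 →
        MeasureTheory.Integrable
          (fun ω => ‖inner ℂ (basisVec μ) (networkResolvent φ ω z (basisVec ν))‖ ^ s) phaseLaw ∧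
        ∫ ω, ‖inner ℂ (basisVec μ) (networkResolvent φ ω z (basisVec ν))‖ ^ s ∂phaseLaw
          ≤ c * Real.exp (-g * siteNorm (μ - ν)) := by
  have hp0 : 0 < s / 2 := by linarith
  have hq0 : 0 < (1 + s) / 2 := by linarith
  obtain ⟨K, hK, hrec⟩ := exists_integral_networkGreen_le_sum hp0 (by linarith)
  have hcos : ∀ p : ℝ, 0 < p → p < 1 → 0 < Real.cos (Real.pi * p / 2) := fun p h0 h1 =>
    Real.cos_pos_of_mem_Ioo ⟨by nlinarith [Real.pi_pos], by nlinarith [Real.pi_pos]⟩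
  set A := 4 * (4 ^ (s / 2) / Real.cos (Real.pi * (s / 2) / 2)) with hA
  set B := 4 * (4 ^ ((1 + s) / 2) / Real.cos (Real.pi * ((1 + s) / 2) / 2)) with hB
  have hApos : 0 < A := by
    have := hcos (s / 2) hp0 (by linarith); positivity
  have hBpos : 0 < B := by
    have := hcos ((1 + s) / 2) hq0 (by linarith); positivity
  set L := Real.exp (-1) / (4 * K) with hL
  have hLpos : 0 < L := by positivity
  -- The choice of $\varphi_0$ makes $4K(16|\varphi|)^{s/2}\le e^{-1}$. The rate and the factor
  -- $e^{1-s}$ come from $n\ge|\mu-\nu|/4-1$ in $e^{-(1-s)n}$.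
  refine ⟨min 1 (L ^ (s / 2)⁻¹ / 16), Real.exp (1 - s) * (A + B), (1 - s) / 4,
    by positivity, by positivity, by linarith, fun φ hφ μ ν z hz => ?_⟩
  simp only [inner_basisVec]
  refine ⟨integrable_norm_networkGreen_rpow φ hz μ ν hs0, ?_⟩
  set f : Site → ℝ := fun x => ∫ ω, ‖networkGreen φ z x ν ω‖ ^ (s / 2) ∂phaseLaw with hf
  have hκ : 4 * (K * (16 * |φ|) ^ (s / 2)) ≤ Real.exp (-1) := by
    have h1 : 16 * |φ| ≤ L ^ (s / 2)⁻¹ := by linarith [hφ.trans (min_le_right _ _)]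
    have h2 : (16 * |φ|) ^ (s / 2) ≤ L := by
      refine (Real.rpow_le_rpow (by positivity) h1 hp0.le).trans (le_of_eq ?_)
      rw [← Real.rpow_mul hLpos.le, inv_mul_cancel₀ hp0.ne', Real.rpow_one]
    have h3 : 4 * K * L = Real.exp (-1) := by rw [hL]; field_simp
    rw [← h3, ← mul_assoc]
    gcongr
  have hdecay := le_mul_exp_of_le_sum (f := f) (y := ν) (C := A)
    (fun x => integral_norm_networkGreen_rpow_le hp0 (by linarith) φ hz x ν) hApos.le
    (by positivity) hκ (fun x hx => hrec φ (hφ.trans (min_le_left _ _)) z hz x ν hx)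
  set d : ℤ := max |μ.1 - ν.1| |μ.2 - ν.2| with hd
  have hd0 : 0 ≤ d := (abs_nonneg _).trans (le_max_left _ _)
  set n : ℕ := (d / 2).toNat with hn
  have hn1 : 2 * (n : ℤ) ≤ d := by omega
  have hn2 : d ≤ 2 * (n : ℤ) + 1 := by omega
  have hX := hdecay n μ hn1
  have hY := integral_norm_networkGreen_rpow_le hq0 (by linarith) φ hz μ ν
  rw [← hB] at hY
  have hnorm : siteNorm (μ - ν) / 4 - 1 ≤ n := by
    have h1 : siteNorm (μ - ν) ≤ 2 * (d : ℝ) := siteNorm_le_two_mul_max (μ - ν)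
    have h2 : (d : ℝ) ≤ 2 * n + 1 := by exact_mod_cast hn2
    linarith
  have i1 := integrable_norm_networkGreen_rpow φ hz μ ν hp0
  have i2 := integrable_norm_networkGreen_rpow φ hz μ ν hq0
  -- The weights balance: $e^{sn}e^{-n}$ from the decay at order $s/2$ equals the factor
  -- $e^{-(1-s)n}$ of the bounded moment.
  calc ∫ ω, ‖networkGreen φ z μ ν ω‖ ^ s ∂phaseLaw
      ≤ ∫ ω, (Real.exp (s * n) * ‖networkGreen φ z μ ν ω‖ ^ (s / 2)
          + Real.exp (-(1 - s) * n) * ‖networkGreen φ z μ ν ω‖ ^ ((1 + s) / 2)) ∂phaseLaw :=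
        integral_mono (integrable_norm_networkGreen_rpow φ hz μ ν hs0)
          ((i1.const_mul _).add (i2.const_mul _))
          fun ω => rpow_le_geometric_split hs0 hs1 (norm_nonneg _) n
    _ = Real.exp (s * n) * f μ + Real.exp (-(1 - s) * n) *
          ∫ ω, ‖networkGreen φ z μ ν ω‖ ^ ((1 + s) / 2) ∂phaseLaw := by
        rw [integral_add (i1.const_mul _) (i2.const_mul _), integral_const_mul, integral_const_mul]
    _ ≤ Real.exp (s * n) * (A * Real.exp (-n)) + Real.exp (-(1 - s) * n) * B := by gcongr
    _ = Real.exp (-(1 - s) * n) * (A + B) := by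
        have : Real.exp (s * n) * (A * Real.exp (-n)) = A * Real.exp (-(1 - s) * n) := by
          rw [mul_left_comm, ← Real.exp_add]; congr 2; ring
        rw [this]; ring
    _ ≤ Real.exp (1 - s + -((1 - s) / 4) * siteNorm (μ - ν)) * (A + B) := by
        gcongr
        nlinarith
    _ = _ := by rw [Real.exp_add]; ring
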